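/- Let $n\ge 1$, let $\mathbb{B}_n$ be the open unit ball of $\mathbb{C}^n$ with the Euclidean norm $|\cdot|$, and let $V$ be Lebesgue measure on $\mathbb{B}_n$ normalized so that $V(\mathbb{B}_n)=1$. Let $p:\mathbb{B}_n\to\mathbb{R}$ satisfy $1<p^-:=\operatorname{ess\,inf} p\le p^+:=\operatorname{ess\,sup} p<\infty$ and be log-Hölder continuous, that is, there is a constant $C_{\log}>0$ with $|p(z)-p(w)|\le C_{\log}/\log\frac{1}{|z-w|}$ for all $z,w\in\mathbb{B}_n$ with $|z-w|<\frac12$ (the right-hand side is read as $0$ when $z=w$). For a positive Borel measure $\mu$ on $\mathbb{B}_n$ and a measurable function $f:\mathbb{B}_n\to\mathbb{C}$ put $$\rho_{p(\cdot),\mu}(f)=\int_{\mathbb{B}_n}|f(z)|^{p(z)}\,d\mu(z),\qquad \|f\|_{p(\cdot),\mu}=\inf\{\gamma>0:\rho_{p(\cdot),\mu}(f/\gamma)\le 1\},$$ (with $\inf\emptyset=\infty$), and write $\|f\|_{p(\cdot)}=\|f\|_{p(\cdot),V}$. Let $A^{p(\cdot)}(\mathbb{B}_n)$ be the space of holomorphic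 functions $f$ on $\mathbb{B}_n$ with $\rho_{p(\cdot),V}(f)<\infty$, normed by $\|\cdot\|_{p(\cdot)}$. The measure $\mu$ is called a Carleson measure for $A^{p(\cdot)}(\mathbb{B}_n)$ if there is a constant $C>0$ with $\|f\|_{p(\cdot),\mu}\le C\|f\|_{p(\cdot)}$ for all $f\in A^{p(\cdot)}(\mathbb{B}_n)$. Let $u:\mathbb{B}_n\to\mathbb{C}$ and $\varphi:\mathbb{B}_n\to\mathbb{B}_n$ be holomorphic, let $C_{u,\varphi}f=u\cdot(f\circ\varphi)$, and define $$\omega_\varphi(z)=\left(\frac{1}{1-|\varphi(z)|^2}\right)^{(n+1)\frac{p(z)-p(\varphi(z))}{p(\varphi(z))}},\qquad \mu_{u,\varphi}(E)=\int_{\varphi^{-1}(E)}|u(z)|^{p(z)}\omega_\varphi(z)\,dV(z)$$ for $z\in\mathbb{B}_n$ and Borel sets $E\subset\mathbb{B}_n$. **Proposition 4.1.** If $C_{u,\varphi}$ is bounded on $A^{p(\cdot)}(\mathbb{B}_n)$ (that is, it maps $A^{p(\cdot)}(\mathbb{B}_n)$ into itself and there is $C>0$ with $\|C_{u,\varphi}f\|_{p(\cdot)}\le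 C\|f\|_{p(\cdot)}$ for all $f\in A^{p(\cdot)}(\mathbb{B}_n)$), then $u\in A^{p(\cdot)}(\mathbb{B}_n)$ and (i) $\displaystyle \sup_{z\in\mathbb{B}_n}|u(z)|\,\frac{(1-|z|^2)^{(n+1)/p(z)}}{(1-|\varphi(z)|^2)^{(n+1)/p(\varphi(z))}}<\infty$; (ii) $\mu_{u,\varphi}$ is a Carleson measure for $A^{p(\cdot)}(\mathbb{B}_n)$. -/

import Mathlib

open MeasureTheory
open scoped ENNReal

noncomputable section

namespace VarBergman

/-- Complex Euclidean space `ℂⁿ`. -/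
abbrev Cn (n : ℕ) : Type := EuclideanSpace ℂ (Fin n)

/-- The open unit ball `𝔹ₙ` of `ℂⁿ`. Functions on the ball are represented by total functions on
`ℂⁿ`; every notion below only looks at their values on the ball. -/
abbrev unitBall (n : ℕ) : Set (Cn n) := Metric.ball (0 : Cn n) 1

/-- `dV`: Lebesgue measure on the ball, normalized so that `V(𝔹ₙ) = 1`. -/
def ballVolume (n : ℕ) : Measure (Cn n) :=
  (volume (unitBall n))⁻¹ • volume.restrict (unitBall n)

/-- `p⁺ = ess sup p` (with respect to `dV`), as an extended real number. -/
def expSup {n : ℕ} (p : Cn n → ℝ) : EReal :=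
  essSup (fun z => (p z : EReal)) (ballVolume n)

/-- `p⁻ = ess inf p` (with respect to `dV`), as an extended real number. -/
def expInf {n : ℕ} (p : Cn n → ℝ) : EReal :=
  essInf (fun z => (p z : EReal)) (ballVolume n)

/-- Log-Hölder continuity on the ball. For `z = w` the inequality reads `0 ≤ 0`. -/
def LogHolder {n : ℕ} (p : Cn n → ℝ) : Prop :=
  ∃ C : ℝ, 0 < C ∧ ∀ z ∈ unitBall n, ∀ w ∈ unitBall n, ‖z - w‖ < 1 / 2 →
    |p z - p w| ≤ C / Real.log (1 / ‖z - w‖)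

/-- The class `𝒫^log(𝔹ₙ)`: log-Hölder continuous exponents with `1 < p⁻ ≤ p⁺ < ∞`. -/
def LogExponent {n : ℕ} (p : Cn n → ℝ) : Prop :=
  LogHolder p ∧ 1 < expInf p ∧ expInf p ≤ expSup p ∧ expSup p < ⊤

/-- The modular `ρ_{p(·),μ}(f) = ∫_{𝔹ₙ} |f(z)|^{p(z)} dμ(z)`, with values in `[0,∞]`. -/
def modular {n : ℕ} (p : Cn n → ℝ) (μ : Measure (Cn n)) (f : Cn n → ℂ) : ℝ≥0∞ :=
  ∫⁻ z in unitBall n, ENNReal.ofReal (‖f z‖ ^ p z) ∂μ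

/-- The Luxemburg–Nakano norm `‖f‖_{p(·),μ} = inf {γ > 0 : ρ_{p(·),μ}(f/γ) ≤ 1}`, with values in
`[0,∞]` (it is `∞` when there is no such `γ`). -/
def luxNorm {n : ℕ} (p : Cn n → ℝ) (μ : Measure (Cn n)) (f : Cn n → ℂ) : ℝ≥0∞ :=
  sInf {c : ℝ≥0∞ | ∃ γ : ℝ, 0 < γ ∧ c = ENNReal.ofReal γ ∧
    modular p μ (fun z => f z / (γ : ℂ)) ≤ 1}

/-- The variable exponent Bergman space `A^{p(·)}(𝔹ₙ) = L^{p(·)}(𝔹ₙ, dV) ∩ H(𝔹ₙ)`. -/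
def bergman {n : ℕ} (p : Cn n → ℝ) : Set (Cn n → ℂ) :=
  {f | DifferentiableOn ℂ f (unitBall n) ∧ modular p (ballVolume n) f < ⊤}

/-- `μ` is a Carleson measure for `A^{p(·)}(𝔹ₙ)`: `‖f‖_{p(·),μ} ≤ C ‖f‖_{p(·)}` for all `f` in
`A^{p(·)}(𝔹ₙ)`. -/
def IsCarleson {n : ℕ} (p : Cn n → ℝ) (μ : Measure (Cn n)) : Prop :=
  ∃ C : ℝ, 0 < C ∧ ∀ f ∈ bergman p,
    luxNorm p μ f ≤ ENNReal.ofReal C * luxNorm p (ballVolume n) f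

/-- The weighted composition operator `C_{u,φ} f = u · (f ∘ φ)`. -/
def wComp {n : ℕ} (u : Cn n → ℂ) (φ : Cn n → Cn n) (f : Cn n → ℂ) : Cn n → ℂ :=
  fun z => u z * f (φ z)

/-- `C_{u,φ}` is a bounded operator on `A^{p(·)}(𝔹ₙ)`: it maps the space into itself, with
`‖C_{u,φ} f‖_{p(·)} ≤ C ‖f‖_{p(·)}`. -/
def WCompBounded {n : ℕ} (p : Cn n → ℝ) (u : Cn n → ℂ) (φ : Cn n → Cn n) : Prop :=
  ∃ C : ℝ, 0 < C ∧ ∀ f ∈ bergman p, wComp u φ f ∈ bergman p ∧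
    luxNorm p (ballVolume n) (wComp u φ f) ≤ ENNReal.ofReal C * luxNorm p (ballVolume n) f

/-- The weight
`ω_φ(z) = (1 / (1 - |φ(z)|²)) ^ ((n+1) (p(z) - p(φ(z))) / p(φ(z)))`. -/
def omegaWeight {n : ℕ} (p : Cn n → ℝ) (φ : Cn n → Cn n) (z : Cn n) : ℝ :=
  (1 / (1 - ‖φ z‖ ^ 2)) ^ (((n : ℝ) + 1) * ((p z - p (φ z)) / p (φ z)))

/-- The weighted pull-back measure `μ_{u,φ}(E) = ∫_{φ⁻¹(E)} |u(z)|^{p(z)} ω_φ(z) dV(z)`, that is,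
the image under `φ` of the measure `|u|^{p(·)} ω_φ dV`. (A `φ` that is continuous on the ball is
a.e. measurable for that measure, which lives on the ball, so `Measure.map` is the usual image.) -/
def pullbackMeasure {n : ℕ} (p : Cn n → ℝ) (u : Cn n → ℂ) (φ : Cn n → Cn n) : Measure (Cn n) :=
  ((ballVolume n).withDensity
    (fun z => ENNReal.ofReal (‖u z‖ ^ p z * omegaWeight p φ z))).map φ

end VarBergman

end

open MeasureTheory
open scoped ENNReal

namespace VarBergman

variable {n : ℕ} {p : Cn n → ℝ}

/-! Everything reduces to modular estimates at the scale of a Bergman ball. `Near w z` says that 1 -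
|φ_w(z)|² ≥ 1/4 for the ball involution φ_w exchanging 0 and w, so 1 - |·|² is comparable at the two
points. On such pairs log-Hölder continuity makes p vary by O(1 / (1 + log(1/(1-|w|²)))), so
changing p(w) to p(z) in a power of 1 - |w|² costs only a constant factor
(`LogExponent.exists_osc_bound`).

Two tools follow. `LogExponent.exists_point_estimate`: if f has modular at most 1, then |f(w)|^p(w)
is at most a constant times `dens w` times the integral of 1 + |f|^p over the points near w.
`LogExponent.exists_modular_testFn_le`: the functions `testFn p M a`, of size `dens a ^ (1 / p a)`
at a, have uniformly bounded modular; `LogExponent.exists_dens_rpow_le_norm_testFn` says that they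
stay that large near a.

For (i), apply the operator to the test function at φ(z) and evaluate the result at z by the point
estimate. For (ii), the weight ω_φ is chosen so that ω_φ(z) `dens (φ z)` is the p(z)-th power of the
peak size at φ(z) (`omegaWeight_mul_dens`). Boundedness on test functions therefore gives a
geometric Carleson condition, uniform over Bergman balls (`LogExponent.exists_lintegral_near_le`).
Integrating the point estimate against μ and applying Tonelli turns this condition into the Carleson
inequality. Finally u is the image of the constant 1. -/

/-! ### Elementary geometry of the ball and of Bergman neighbourhoods. -/

theorem one_sub_sq_pos {w : Cn n} (hw : w ∈ unitBall n) : 0 < 1 - ‖w‖ ^ 2 := by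
  have h : ‖w‖ < 1 := by simpa using hw
  nlinarith [norm_nonneg w]

theorem one_sub_sq_le_one (w : Cn n) : 1 - ‖w‖ ^ 2 ≤ 1 := by
  nlinarith [sq_nonneg ‖w‖]

theorem norm_one_sub_inner_symm (w z : Cn n) :
    ‖1 - inner ℂ w z‖ = ‖1 - inner ℂ z w‖ := by
  rw [← RCLike.norm_conj (1 - inner ℂ w z), map_sub, map_one, inner_conj_symm]

/-- Expanding the square gives |w - z|² = 2 Re(1 - ⟨w,z⟩) - (1 - |w|²) - (1 - |z|²). -/
theorem norm_sub_sq_le {w z : Cn n} (hw : w ∈ unitBall n) (hz : z ∈ unitBall n) :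
    ‖w - z‖ ^ 2 ≤ 2 * ‖1 - inner ℂ w z‖ := by
  have h1 := one_sub_sq_pos hw
  have h2 := one_sub_sq_pos hz
  have h3 := Complex.re_le_norm (1 - inner ℂ w z)
  have h4 := norm_sub_sq (𝕜 := ℂ) w z
  simp only [Complex.sub_re, Complex.one_re, RCLike.re_eq_complex_re] at h3 h4
  linarith

theorem one_sub_sq_le_norm {w z : Cn n} (hz : z ∈ unitBall n) :
    1 - ‖w‖ ^ 2 ≤ 2 * ‖1 - inner ℂ w z‖ := by
  have h1 := one_sub_sq_pos hz
  have h3 := Complex.re_le_norm (1 - inner ℂ w z)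
  have h4 := norm_sub_sq (𝕜 := ℂ) w z
  simp only [Complex.sub_re, Complex.one_re, RCLike.re_eq_complex_re] at h3 h4
  nlinarith [sq_nonneg ‖w - z‖]

theorem norm_one_sub_inner_pos {w z : Cn n} (hw : w ∈ unitBall n) (hz : z ∈ unitBall n) :
    0 < ‖1 - inner ℂ w z‖ := by
  linarith [one_sub_sq_pos hw, one_sub_sq_le_norm (w := w) hz]

theorem one_sub_inner_ne_zero {w z : Cn n} (hw : w ∈ unitBall n) (hz : z ∈ unitBall n) :
    1 - inner ℂ w z ≠ 0 :=
  norm_pos_iff.mp (norm_one_sub_inner_pos hw hz)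

/-- Pairs of points of the ball at bounded Bergman distance. -/
def Near (w z : Cn n) : Prop :=
  w ∈ unitBall n ∧ z ∈ unitBall n ∧
    ‖1 - inner ℂ w z‖ ^ 2 ≤ 4 * ((1 - ‖w‖ ^ 2) * (1 - ‖z‖ ^ 2))

theorem Near.symm {w z : Cn n} (h : Near w z) : Near z w := by
  refine ⟨h.2.1, h.1, ?_⟩
  rw [norm_one_sub_inner_symm, mul_comm (1 - ‖z‖ ^ 2)]
  exact h.2.2

theorem Near.one_sub_sq_le {w z : Cn n} (h : Near w z) :
    1 - ‖w‖ ^ 2 ≤ 16 * (1 - ‖z‖ ^ 2) := by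
  obtain ⟨hw, hz, h⟩ := h
  have h1 := one_sub_sq_pos hw
  have h2 := one_sub_sq_le_norm (w := w) hz
  by_contra! hc
  have h3 : (1 - ‖w‖ ^ 2) ^ 2 ≤ 4 * ‖1 - inner ℂ w z‖ ^ 2 := by nlinarith
  nlinarith

theorem Near.norm_one_sub_inner_le {w z : Cn n} (h : Near w z) :
    ‖1 - inner ℂ w z‖ ≤ 8 * (1 - ‖z‖ ^ 2) := by
  have h1 := h.one_sub_sq_le
  have h2 := one_sub_sq_pos h.2.1
  have h3 := h.2.2
  refine le_of_sq_le_sq ?_ (by positivity)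
  nlinarith

/-- The natural bound is |w - z|² ≤ 16 (1 - |w|²). It is weakened to a fourth power so that one
oscillation bound also serves the larger region |1 - ⟨a,z⟩|² ≤ 1 - |a|² used for test functions. -/
theorem Near.norm_sub_pow_le {w z : Cn n} (h : Near w z) :
    ‖w - z‖ ^ 4 ≤ 256 * (1 - ‖w‖ ^ 2) := by
  have h1 := norm_sub_sq_le h.1 h.2.1
  have h2 := h.symm.norm_one_sub_inner_le
  rw [norm_one_sub_inner_symm] at h2
  have h3 := one_sub_sq_pos h.1
  have h4 := one_sub_sq_le_one w
  have h5 : ‖w - z‖ ^ 2 ≤ 16 * (1 - ‖w‖ ^ 2) := by linarith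
  calc ‖w - z‖ ^ 4 = (‖w - z‖ ^ 2) ^ 2 := by ring
    _ ≤ (16 * (1 - ‖w‖ ^ 2)) ^ 2 := by gcongr
    _ ≤ _ := by nlinarith

theorem measurableSet_near : MeasurableSet {x : Cn n × Cn n | Near x.1 x.2} := by
  have h1 : MeasurableSet {x : Cn n × Cn n | x.1 ∈ unitBall n} :=
    measurable_fst Metric.isOpen_ball.measurableSet
  have h2 : MeasurableSet {x : Cn n × Cn n | x.2 ∈ unitBall n} :=
    measurable_snd Metric.isOpen_ball.measurableSet
  have h3 : MeasurableSet {x : Cn n × Cn n | ‖1 - inner ℂ x.1 x.2‖ ^ 2 ≤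
      4 * ((1 - ‖x.1‖ ^ 2) * (1 - ‖x.2‖ ^ 2))} :=
    (isClosed_le (by fun_prop) (by fun_prop)).measurableSet
  exact h1.inter (h2.inter h3)

theorem measurableSet_near_left (w : Cn n) : MeasurableSet {z : Cn n | Near w z} :=
  measurable_prodMk_left (x := w) measurableSet_near

/-! ### Volumes of anisotropic neighbourhoods. -/

/-- The linear map `v ↦ v + t ⟨v, w⟩ w`. -/
noncomputable def stretch (w : Cn n) (t : ℝ) : Cn n →ₗ[ℂ] Cn n :=
  LinearMap.transvection ((innerSL ℂ w : Cn n →L[ℂ] ℂ) : Cn n →ₗ[ℂ] ℂ) ((t : ℂ) • w)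

theorem stretch_apply (w : Cn n) (t : ℝ) (v : Cn n) :
    stretch w t v = v + inner ℂ w v • ((t : ℂ) • w) := by
  simp [stretch, LinearMap.transvection.apply]

theorem det_stretch (w : Cn n) (t : ℝ) :
    LinearMap.det ((stretch w t).restrictScalars ℝ) = (1 + t * ‖w‖ ^ 2) ^ 2 := by
  rw [LinearMap.det_restrictScalars, stretch, LinearMap.transvection.det, Algebra.norm_complex_apply]
  have : (1 : ℂ) + ((innerSL ℂ w : Cn n →L[ℂ] ℂ) : Cn n →ₗ[ℂ] ℂ) ((t : ℂ) • w) =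
      ((1 + t * ‖w‖ ^ 2 : ℝ) : ℂ) := by
    simp [inner_self_eq_norm_sq_to_K]
  rw [this, Complex.normSq_ofReal, ← sq]

theorem volume_preimage_stretch (w : Cn n) {t : ℝ} (ht : 0 ≤ t) {r : ℝ} (hr : 0 < r) :
    volume (stretch w t ⁻¹' Metric.ball 0 r) =
      ENNReal.ofReal (((1 + t * ‖w‖ ^ 2) ^ 2)⁻¹ * r ^ (2 * n)) * volume (unitBall n) := by
  have hd : 0 < (1 + t * ‖w‖ ^ 2) ^ 2 := by positivity
  have h := Measure.addHaar_preimage_linearMap (volume : Measure (Cn n))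
    (f := (stretch w t).restrictScalars ℝ) (by rw [det_stretch]; exact hd.ne') (Metric.ball 0 r)
  rw [det_stretch, abs_of_pos (by positivity)] at h
  refine Eq.trans h ?_
  rw [Measure.addHaar_ball_of_pos _ _ hr, ← mul_assoc, ← ENNReal.ofReal_mul (by positivity)]
  congr 3
  rw [finrank_real_of_complex, finrank_euclideanSpace, Fintype.card_fin]

/-- Points of this set lie within 2√s of a, while their displacement has component O(s) along a.
Stretching the a-direction by about 1/√s puts the set inside a ball of radius 5√s, and the real
determinant supplies the extra factor s. -/
theorem volume_norm_one_sub_lt_le {a : Cn n} (ha : a ∈ unitBall n) {s : ℝ} (hs : 0 < s) :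
    volume {z ∈ unitBall n | ‖1 - inner ℂ a z‖ < s} ≤
      ENNReal.ofReal (4 * 25 ^ n * 4 ^ (n + 1) * s ^ (n + 1)) * volume (unitBall n) := by
  -- For s > 1/4 the right side already exceeds the volume of the ball; this is what the factor
  -- 4^(n+1) is for. For smaller s, a nonempty set forces a close to the sphere.
  rcases le_or_gt s (1 / 4) with h4 | h4
  swap
  · calc volume {z ∈ unitBall n | ‖1 - inner ℂ a z‖ < s} ≤ 1 * volume (unitBall n) := by
          rw [one_mul]; exact measure_mono fun z hz => hz.1
      _ ≤ _ := by
          gcongr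
          rw [← ENNReal.ofReal_one]
          refine ENNReal.ofReal_le_ofReal ?_
          have h1 : (1 : ℝ) ≤ 4 * 25 ^ n := by
            have : (1 : ℝ) ≤ 25 ^ n := one_le_pow₀ (by norm_num)
            linarith
          have h2 : (1 : ℝ) ≤ (4 * s) ^ (n + 1) := one_le_pow₀ (by linarith)
          rw [mul_pow] at h2
          calc (1 : ℝ) ≤ (4 * 25 ^ n) * (4 ^ (n + 1) * s ^ (n + 1)) := one_le_mul_of_one_le_of_one_le h1 h2
            _ = _ := by ring
  rcases Set.eq_empty_or_nonempty {z ∈ unitBall n | ‖1 - inner ℂ a z‖ < s} with h0 | ⟨z₀, hz₀, hz₀s⟩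
  · rw [h0, measure_empty]; exact zero_le
  have ha1 : ‖a‖ < 1 := by simpa using ha
  have hea : 1 - ‖a‖ ^ 2 < 2 * s := by linarith [one_sub_sq_le_norm (w := a) hz₀]
  set r := Real.sqrt s with hr
  have hr0 : 0 < r := Real.sqrt_pos.mpr hs
  have hrs : r ^ 2 = s := Real.sq_sqrt hs.le
  have hsub : {z ∈ unitBall n | ‖1 - inner ℂ a z‖ < s} ⊆
      (fun z => z + -a) ⁻¹' (stretch a r⁻¹ ⁻¹' Metric.ball 0 (5 * r)) := by
    rintro z ⟨hz, hzs⟩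
    have h1 : ‖z + -a‖ < 2 * r := by
      have := norm_sub_sq_le ha hz
      rw [norm_sub_rev, sub_eq_add_neg] at this
      refine lt_of_pow_lt_pow_left₀ 2 (by positivity) ?_
      nlinarith
    have h2 : ‖inner ℂ a (z + -a)‖ ≤ 3 * s := by
      have : inner ℂ a (z + -a) = ((1 - ‖a‖ ^ 2 : ℝ) : ℂ) - (1 - inner ℂ a z) := by
        rw [inner_add_right, inner_neg_right, inner_self_eq_norm_sq_to_K]; push_cast
        simp only [Complex.coe_algebraMap]; ring
      rw [this]
      refine (norm_sub_le _ _).trans ?_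
      rw [Complex.norm_real, Real.norm_eq_abs, abs_of_pos (one_sub_sq_pos ha)]
      linarith
    simp only [Set.mem_preimage, mem_ball_zero_iff, stretch_apply]
    refine (norm_add_le _ _).trans_lt ?_
    have h3 : ‖inner ℂ a (z + -a) • ((r⁻¹ : ℝ) : ℂ) • a‖ ≤ 3 * r := by
      rw [norm_smul, norm_smul, Complex.norm_real, Real.norm_eq_abs, abs_of_pos (by positivity)]
      calc ‖inner ℂ a (z + -a)‖ * (r⁻¹ * ‖a‖) ≤ (3 * s) * (r⁻¹ * 1) := by gcongr
        _ = 3 * r := by rw [← hrs]; field_simp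
    linarith
  refine (measure_mono hsub).trans ?_
  rw [measure_preimage_add_right, volume_preimage_stretch _ (by positivity) (by positivity)]
  refine mul_le_mul_left (ENNReal.ofReal_le_ofReal ?_) _
  have hr2 : r ≤ 1 / 2 := by
    rw [hr, Real.sqrt_le_left (by norm_num)]; norm_num; linarith
  have hd : 1 / (2 * r) ≤ 1 + r⁻¹ * ‖a‖ ^ 2 := by
    rw [div_le_iff₀ (by positivity)]
    have : (1 + r⁻¹ * ‖a‖ ^ 2) * (2 * r) = 2 * r + 2 * ‖a‖ ^ 2 := by field_simp
    rw [this]; nlinarith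
  calc ((1 + r⁻¹ * ‖a‖ ^ 2) ^ 2)⁻¹ * (5 * r) ^ (2 * n)
      ≤ ((1 / (2 * r)) ^ 2)⁻¹ * (5 * r) ^ (2 * n) := by gcongr
    _ = 4 * 25 ^ n * s ^ (n + 1) := by
        rw [← hrs, mul_pow, ← pow_mul, show (5 : ℝ) ^ (2 * n) = 25 ^ n by rw [pow_mul]; norm_num]
        field_simp; ring
    _ ≤ 4 * 25 ^ n * 4 ^ (n + 1) * s ^ (n + 1) := by
        have : (1 : ℝ) ≤ 4 ^ (n + 1) := one_le_pow₀ (by norm_num)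
        have h0 : 0 ≤ 4 * (25 : ℝ) ^ n * s ^ (n + 1) := by positivity
        nlinarith

/-- A circular neighbourhood of `0` whose translate to `w` is comparable to a Bergman ball. -/
def patch (w : Cn n) : Set (Cn n) :=
  stretch w (Real.sqrt (1 - ‖w‖ ^ 2))⁻¹ ⁻¹' Metric.ball 0 (Real.sqrt (1 - ‖w‖ ^ 2) / 8)

theorem isOpen_patch (w : Cn n) : IsOpen (patch w) :=
  Metric.isOpen_ball.preimage (LinearMap.continuous_of_finiteDimensional _)

theorem smul_mem_patch {w v : Cn n} (hv : v ∈ patch w) {c : ℂ} (hc : ‖c‖ ≤ 1) :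
    c • v ∈ patch w := by
  simp only [patch, Set.mem_preimage, mem_ball_zero_iff, map_smul, norm_smul] at hv ⊢
  nlinarith [norm_nonneg (stretch w (Real.sqrt (1 - ‖w‖ ^ 2))⁻¹ v)]

theorem volume_patch_ge {w : Cn n} (hw : w ∈ unitBall n) :
    ENNReal.ofReal ((4 * 64 ^ n)⁻¹ * (1 - ‖w‖ ^ 2) ^ (n + 1)) * volume (unitBall n) ≤
      volume (patch w) := by
  have he := one_sub_sq_pos hw
  have hw1 : ‖w‖ < 1 := by simpa using hw
  set r := Real.sqrt (1 - ‖w‖ ^ 2) with hr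
  have hr0 : 0 < r := Real.sqrt_pos.mpr he
  have hrs : r ^ 2 = 1 - ‖w‖ ^ 2 := Real.sq_sqrt he.le
  have hr1 : r ≤ 1 := by
    rw [hr, Real.sqrt_le_left (by norm_num), one_pow]; exact one_sub_sq_le_one w
  rw [patch, volume_preimage_stretch _ (by positivity) (by positivity), ← hr, ← hrs]
  refine mul_le_mul_left (ENNReal.ofReal_le_ofReal ?_) _
  have hd : 1 + r⁻¹ * ‖w‖ ^ 2 ≤ 2 / r := by
    rw [le_div_iff₀ hr0]
    have : (1 + r⁻¹ * ‖w‖ ^ 2) * r = r + ‖w‖ ^ 2 := by field_simp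
    rw [this]; nlinarith [norm_nonneg w]
  calc (4 * 64 ^ n)⁻¹ * (r ^ 2) ^ (n + 1) = ((2 / r) ^ 2)⁻¹ * (r / 8) ^ (2 * n) := by
        rw [div_pow r, pow_mul (8 : ℝ), ← pow_mul]; norm_num; field_simp; ring
    _ ≤ ((1 + r⁻¹ * ‖w‖ ^ 2) ^ 2)⁻¹ * (r / 8) ^ (2 * n) := by gcongr

/-- With e = 1 - |w|², membership in the patch forces |⟨w,v⟩| ≤ e/8 and |v|² ≤ e/64. These give 1 -
|w+v|² ≥ e/2 and |1 - ⟨w,w+v⟩| ≤ 9e/8, and (9/8)² ≤ 2. -/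
theorem near_add_of_mem_patch {w v : Cn n} (hw : w ∈ unitBall n) (hv : v ∈ patch w) :
    Near w (w + v) := by
  have he := one_sub_sq_pos hw
  have hw1 : ‖w‖ < 1 := by simpa using hw
  set e := 1 - ‖w‖ ^ 2 with hee
  have he1 : e ≤ 1 := one_sub_sq_le_one w
  set r := Real.sqrt e with hr
  have hr0 : 0 < r := Real.sqrt_pos.mpr he
  have hrs : r ^ 2 = e := Real.sq_sqrt he.le
  have hr1 : r ≤ 1 := by
    rw [hr, Real.sqrt_le_left (by norm_num), one_pow]; exact he1
  simp only [patch, Set.mem_preimage, mem_ball_zero_iff, ← hee, ← hr] at hv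
  set c : ℂ := inner ℂ w v with hc
  have hL : stretch w r⁻¹ v = v + c • (((r⁻¹ : ℝ) : ℂ) • w) := stretch_apply _ _ _
  have hcL : inner ℂ w (stretch w r⁻¹ v) = ((1 + r⁻¹ * ‖w‖ ^ 2 : ℝ) : ℂ) * c := by
    rw [hL, inner_add_right, inner_smul_right, inner_smul_right, inner_self_eq_norm_sq_to_K, ← hc]
    push_cast; simp only [Complex.coe_algebraMap]; ring
  have hcb : ‖c‖ ≤ e / 8 := by
    have h1 := norm_inner_le_norm (𝕜 := ℂ) w (stretch w r⁻¹ v)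
    rw [hcL, norm_mul, Complex.norm_real, Real.norm_eq_abs, abs_of_pos (by positivity)] at h1
    have h2 : (1 + r⁻¹ * ‖w‖ ^ 2) * r = r + ‖w‖ ^ 2 := by field_simp
    have h3 : (1 + r⁻¹ * ‖w‖ ^ 2) * ‖c‖ ≤ r / 8 := by
      nlinarith [norm_nonneg w, norm_nonneg (stretch w r⁻¹ v)]
    have h4 : (r + ‖w‖ ^ 2) * ‖c‖ ≤ e / 8 := by rw [← h2, ← hrs]; nlinarith
    have h5 : 1 ≤ r + ‖w‖ ^ 2 := by nlinarith
    nlinarith [norm_nonneg c]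
  have hvb : ‖v‖ ^ 2 ≤ e / 64 := by
    -- The stretch dominates the identity as a positive operator, so it cannot shorten v.
    have h1 : RCLike.re (inner ℂ v (stretch w r⁻¹ v)) = ‖v‖ ^ 2 + r⁻¹ * ‖c‖ ^ 2 := by
      have h2 : inner ℂ v w = (starRingEnd ℂ) c := (inner_conj_symm v w).symm
      have h3 : inner ℂ v (stretch w r⁻¹ v) = ((‖v‖ ^ 2 + r⁻¹ * ‖c‖ ^ 2 : ℝ) : ℂ) := by
        rw [hL, inner_add_right, inner_smul_right, inner_smul_right, inner_self_eq_norm_sq_to_K, h2]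
        have h4 : c * (starRingEnd ℂ) c = ((‖c‖ ^ 2 : ℝ) : ℂ) := by
          rw [Complex.mul_conj, Complex.normSq_eq_norm_sq]
        calc _ = ((‖v‖ : ℝ) : ℂ) ^ 2 + ((r⁻¹ : ℝ) : ℂ) * (c * (starRingEnd ℂ) c) := by
              simp only [Complex.coe_algebraMap]; ring
          _ = _ := by rw [h4]; push_cast; ring
      rw [h3]; exact Complex.ofReal_re _
    have h2 := re_inner_le_norm (𝕜 := ℂ) v (stretch w r⁻¹ v)
    rw [h1] at h2
    have h3 : 0 ≤ r⁻¹ * ‖c‖ ^ 2 := by positivity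
    have h4 : ‖v‖ ≤ r / 8 := by
      by_contra! h
      nlinarith [norm_nonneg v, norm_nonneg (stretch w r⁻¹ v)]
    nlinarith [norm_nonneg v]
  have hn := norm_add_sq (𝕜 := ℂ) w v
  have hre := Complex.re_le_norm c
  simp only [RCLike.re_eq_complex_re, ← hc] at hn
  have hb : e / 2 ≤ 1 - ‖w + v‖ ^ 2 := by
    rw [hn]; nlinarith
  refine ⟨hw, ?_, ?_⟩
  · rw [mem_ball_zero_iff]
    nlinarith [norm_nonneg (w + v)]
  · have h1 : (1 : ℂ) - inner ℂ w (w + v) = (e : ℂ) - c := by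
      rw [inner_add_right, inner_self_eq_norm_sq_to_K, hee, ← hc]; push_cast
      simp only [Complex.coe_algebraMap]; ring
    have h2 : ‖(1 : ℂ) - inner ℂ w (w + v)‖ ≤ e + e / 8 := by
      rw [h1]
      refine (norm_sub_le _ _).trans ?_
      rw [Complex.norm_real, Real.norm_eq_abs, abs_of_pos he]
      linarith
    rw [← hee]
    calc ‖(1 : ℂ) - inner ℂ w (w + v)‖ ^ 2 ≤ (e + e / 8) ^ 2 := by gcongr
      _ ≤ 4 * (e * (e / 2)) := by nlinarith
      _ ≤ _ := by gcongr

theorem volume_patch_ne_top {w : Cn n} (hw : w ∈ unitBall n) : volume (patch w) ≠ ⊤ := by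
  have h : patch w ⊆ (fun v => w + v) ⁻¹' unitBall n := fun v hv =>
    (near_add_of_mem_patch hw hv).2.1
  refine ne_top_of_le_ne_top ?_ (measure_mono h)
  rw [measure_preimage_add]
  exact measure_ball_lt_top.ne

theorem volume_unitBall_pos : 0 < volume (unitBall n) := Metric.measure_ball_pos _ _ one_pos

theorem volume_unitBall_ne_top : volume (unitBall n) ≠ ⊤ := measure_ball_lt_top.ne

theorem volume_patch_pos {w : Cn n} (hw : w ∈ unitBall n) : 0 < volume (patch w) := by
  have he := one_sub_sq_pos hw
  refine lt_of_lt_of_le ?_ (volume_patch_ge hw)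
  refine ENNReal.mul_pos (ENNReal.ofReal_pos.mpr (by positivity)).ne' volume_unitBall_pos.ne'

/-! ### The sub-mean-value inequality. -/

theorem enorm_mul_le_lintegral_circle {g : ℂ → ℂ}
    (hg : DiffContOnCl ℂ g (Metric.ball 0 1)) :
    ‖g 0‖ₑ * ENNReal.ofReal (2 * Real.pi) ≤
      ∫⁻ θ in Set.Ioc 0 (2 * Real.pi), ‖g (circleMap 0 1 θ)‖ₑ := by
  have h := DiffContOnCl.circleAverage (f := g) (c := 0) (R := 1) (by simpa using hg)
  have hpi : (0 : ℝ) < 2 * Real.pi := by positivity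
  rw [Real.circleAverage_def, intervalIntegral.integral_of_le hpi.le] at h
  rw [← h, enorm_smul, mul_comm, ← mul_assoc]
  have : ENNReal.ofReal (2 * Real.pi) * ‖(2 * Real.pi)⁻¹‖ₑ = 1 := by
    rw [Real.enorm_of_nonneg (by positivity), ← ENNReal.ofReal_mul hpi.le, mul_inv_cancel₀ hpi.ne',
      ENNReal.ofReal_one]
  rw [this, one_mul]
  exact enorm_integral_le_lintegral_enorm _

theorem lintegral_comp_unit_smul {c : ℂ} (hc : ‖c‖ = 1) (G : Cn n → ℝ≥0∞) :
    ∫⁻ v, G (c • v) = ∫⁻ v, G v := by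
  have hc0 : c ≠ 0 := norm_pos_iff.mp (by rw [hc]; exact one_pos)
  let e : Cn n ≃ₗᵢ[ℝ] Cn n :=
    { (LinearEquiv.smulOfNeZero ℂ (Cn n) c hc0).restrictScalars ℝ with
      norm_map' := fun v => by
        change ‖c • v‖ = ‖v‖
        rw [norm_smul, hc, one_mul] }
  exact e.measurePreserving.lintegral_comp_emb e.toHomeomorph.measurableEmbedding G

/-- The patch is invariant under unimodular scalars. The one-variable mean value property on each
disc τ ↦ w + τv, integrated over v, gives the bound after Tonelli and rotation invariance of
Lebesgue measure. -/
theorem enorm_mul_volume_patch_le {f : Cn n → ℂ} (hf : DifferentiableOn ℂ f (unitBall n))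
    {w : Cn n} (hw : w ∈ unitBall n) :
    ‖f w‖ₑ * volume (patch w) ≤ ∫⁻ v in patch w, ‖f (w + v)‖ₑ := by
  classical
  set G : Cn n → ℝ≥0∞ := (patch w).indicator fun v => ‖f (w + v)‖ₑ with hG
  have hGm : Measurable G := by
    have hc : ContinuousOn (fun v => ‖f (w + v)‖ₑ) (patch w) := by
      refine continuous_enorm.comp_continuousOn (hf.continuousOn.comp (by fun_prop) ?_)
      exact fun v hv => (near_add_of_mem_patch hw hv).2.1
    have := hc.measurable_piecewise (g := (0 : Cn n → ℝ≥0∞)) continuous_zero.continuousOn (isOpen_patch w).measurableSet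
    rwa [Set.piecewise_eq_indicator] at this
  have hcirc : ∀ θ : ℝ, ‖circleMap 0 1 θ‖ = 1 := fun θ => by simp
  have hpt : ∀ v, (patch w).indicator (fun _ => ‖f w‖ₑ * ENNReal.ofReal (2 * Real.pi)) v ≤
      ∫⁻ θ in Set.Ioc 0 (2 * Real.pi), G (circleMap 0 1 θ • v) := by
    intro v
    by_cases hv : v ∈ patch w
    swap
    · rw [Set.indicator_of_notMem hv]; exact zero_le
    rw [Set.indicator_of_mem hv]
    have hmaps : Set.MapsTo (fun τ : ℂ => w + τ • v) (Metric.closedBall 0 1) (unitBall n) :=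
      fun τ hτ => (near_add_of_mem_patch hw (smul_mem_patch hv (by simpa using hτ))).2.1
    have hd : DiffContOnCl ℂ (fun τ : ℂ => f (w + τ • v)) (Metric.ball 0 1) := by
      refine DifferentiableOn.diffContOnCl ?_
      rw [closure_ball _ one_ne_zero]
      exact hf.comp (by fun_prop) hmaps
    have h := enorm_mul_le_lintegral_circle hd
    simp only [zero_smul, add_zero] at h
    refine h.trans_eq (lintegral_congr fun θ => ?_)
    rw [hG, Set.indicator_of_mem (smul_mem_patch hv (hcirc θ).le)]
  have hpi : ENNReal.ofReal (2 * Real.pi) ≠ 0 := by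
    rw [Ne, ENNReal.ofReal_eq_zero, not_le]; positivity
  have hint := lintegral_mono (μ := volume) hpt
  rw [lintegral_indicator (isOpen_patch w).measurableSet, setLIntegral_const,
    lintegral_lintegral_swap] at hint
  swap
  · refine (hGm.comp ?_).aemeasurable
    exact (((continuous_circleMap 0 1).comp continuous_snd).smul continuous_fst).measurable
  simp only [lintegral_comp_unit_smul (hcirc _)] at hint
  rw [setLIntegral_const, Real.volume_Ioc, sub_zero, hG,
    lintegral_indicator (isOpen_patch w).measurableSet, mul_right_comm] at hint
  exact (ENNReal.mul_le_mul_iff_left hpi ENNReal.ofReal_ne_top).mp hint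

theorem enorm_rpow_mul_volume_patch_le {f : Cn n → ℂ} (hf : DifferentiableOn ℂ f (unitBall n))
    {w : Cn n} (hw : w ∈ unitBall n) {q : ℝ} (hq : 1 ≤ q) :
    ‖f w‖ₑ ^ q * volume (patch w) ≤ ∫⁻ v in patch w, ‖f (w + v)‖ₑ ^ q := by
  have hq0 : 0 < q := by linarith
  have hm : AEStronglyMeasurable (fun v => f (w + v)) (volume.restrict (patch w)) := by
    refine ContinuousOn.aestronglyMeasurable ?_ (isOpen_patch w).measurableSet
    refine hf.continuousOn.comp (by fun_prop) ?_
    exact fun v hv => (near_add_of_mem_patch hw hv).2.1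
  -- Hölder on the finite-volume patch passes from exponent 1 to exponent q.
  have h1 := eLpNorm'_le_eLpNorm'_mul_rpow_measure_univ (p := 1) (q := q) one_pos hq hm
  have h2 := enorm_mul_volume_patch_le hf hw
  have hV0 := (volume_patch_pos hw).ne'
  have hVt := volume_patch_ne_top hw
  simp only [eLpNorm', ENNReal.rpow_one, div_one, Measure.restrict_apply_univ] at h1
  set V := volume (patch w)
  set I := ∫⁻ v in patch w, ‖f (w + v)‖ₑ ^ q
  have h3 := ENNReal.rpow_le_rpow (h2.trans h1) hq0.le
  rw [ENNReal.mul_rpow_of_nonneg _ _ hq0.le, ENNReal.mul_rpow_of_nonneg _ _ hq0.le,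
    ← ENNReal.rpow_mul, ← ENNReal.rpow_mul, one_div_mul_cancel hq0.ne', ENNReal.rpow_one,
    sub_mul, one_mul, one_div_mul_cancel hq0.ne'] at h3
  have h4 : V ^ q = V * V ^ (q - 1) := by
    conv_lhs => rw [show q = 1 + (q - 1) by ring, ENNReal.rpow_add _ _ hV0 hVt, ENNReal.rpow_one]
  rw [h4, ← mul_assoc] at h3
  refine (ENNReal.mul_le_mul_iff_left ?_ ?_).mp h3
  · exact (ENNReal.rpow_pos (volume_patch_pos hw) hVt).ne'
  · exact ENNReal.rpow_ne_top_of_nonneg (by linarith) hVt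

/-- Sub-mean-value inequality over Bergman-type neighbourhoods. -/
theorem enorm_rpow_le_lintegral_near {f : Cn n → ℂ} (hf : DifferentiableOn ℂ f (unitBall n))
    {w : Cn n} (hw : w ∈ unitBall n) {q : ℝ} (hq : 1 ≤ q) :
    ‖f w‖ₑ ^ q * ENNReal.ofReal ((4 * 64 ^ n)⁻¹ * (1 - ‖w‖ ^ 2) ^ (n + 1)) ≤
      ∫⁻ z in {z | Near w z}, ‖f z‖ₑ ^ q ∂ballVolume n := by
  have h1 := enorm_rpow_mul_volume_patch_le hf hw hq
  have h2 : ∫⁻ v in patch w, ‖f (w + v)‖ₑ ^ q ≤ ∫⁻ z in {z | Near w z}, ‖f z‖ₑ ^ q := by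
    rw [← lintegral_indicator (isOpen_patch w).measurableSet,
      ← lintegral_indicator (measurableSet_near_left w),
      ← lintegral_add_left_eq_self ({z | Near w z}.indicator fun z => ‖f z‖ₑ ^ q) w]
    refine lintegral_mono fun v => ?_
    by_cases hv : v ∈ patch w
    · rw [Set.indicator_of_mem hv, Set.indicator_of_mem]
      exact near_add_of_mem_patch hw hv
    · rw [Set.indicator_of_notMem hv]; exact zero_le
  have h3 : ∫⁻ z in {z | Near w z}, ‖f z‖ₑ ^ q ∂ballVolume n =
      (volume (unitBall n))⁻¹ * ∫⁻ z in {z | Near w z}, ‖f z‖ₑ ^ q := by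
    rw [ballVolume, Measure.restrict_smul, lintegral_smul_measure,
      Measure.restrict_restrict (measurableSet_near_left w),
      Set.inter_eq_left.mpr (show {z | Near w z} ⊆ unitBall n from fun z hz => hz.2.1), smul_eq_mul]
  rw [h3, mul_comm (volume (unitBall n))⁻¹, ← div_eq_mul_inv,
    ENNReal.le_div_iff_mul_le (Or.inl volume_unitBall_pos.ne') (Or.inl volume_unitBall_ne_top)]
  calc _ ≤ ‖f w‖ₑ ^ q * volume (patch w) := by
        rw [mul_assoc]; gcongr; exact volume_patch_ge hw
    _ ≤ _ := h1.trans h2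

/-! ### Normalized volume, and consequences of log-Hölder continuity. -/

/-- The inverse of `(1 - |w|²)^(n+1)`, comparable to the inverse volume of a Bergman ball. -/
noncomputable def dens (w : Cn n) : ℝ := ((1 - ‖w‖ ^ 2) ^ (n + 1))⁻¹

theorem dens_pos {w : Cn n} (hw : w ∈ unitBall n) : 0 < dens w := by
  have := one_sub_sq_pos hw
  unfold dens; positivity

theorem dens_rpow {w : Cn n} (hw : w ∈ unitBall n) (t : ℝ) :
    dens w ^ t = ((1 / (1 - ‖w‖ ^ 2)) ^ t) ^ (n + 1) := by
  have := one_sub_sq_pos hw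
  rw [dens, ← inv_pow, ← one_div, ← Real.rpow_natCast_mul (by positivity),
    ← Real.rpow_mul_natCast (by positivity), mul_comm t]

instance isProbabilityMeasure_ballVolume : IsProbabilityMeasure (ballVolume n) := by
  refine ⟨?_⟩
  rw [ballVolume, Measure.smul_apply, Measure.restrict_apply_univ, smul_eq_mul,
    ENNReal.inv_mul_cancel volume_unitBall_pos.ne' volume_unitBall_ne_top]

theorem ballVolume_le_smul (s : Set (Cn n)) :
    ballVolume n s ≤ (volume (unitBall n))⁻¹ * volume s := by
  rw [ballVolume, Measure.smul_apply, smul_eq_mul]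
  gcongr
  exact Measure.restrict_le_self

theorem ae_mem_unitBall : ∀ᵐ z ∂ballVolume n, z ∈ unitBall n :=
  Measure.ae_smul_measure (ae_restrict_mem Metric.isOpen_ball.measurableSet) _

theorem restrict_ballVolume : (ballVolume n).restrict (unitBall n) = ballVolume n :=
  Measure.restrict_eq_self_of_ae_mem ae_mem_unitBall

theorem ballVolume_pos_of_isOpen {s : Set (Cn n)} (hs : IsOpen s) (hne : s.Nonempty)
    (hsub : s ⊆ unitBall n) : 0 < ballVolume n s := by
  rw [ballVolume, Measure.smul_apply, smul_eq_mul, Measure.restrict_apply hs.measurableSet,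
    Set.inter_eq_left.mpr hsub]
  exact ENNReal.mul_pos (ENNReal.inv_ne_zero.mpr volume_unitBall_ne_top) (hs.measure_pos _ hne).ne'

/-- Nonempty open subsets of the ball have positive measure. Hence essential bounds on a continuous
exponent hold at every point. -/
theorem forall_mem_unitBall_of_ae {f : Cn n → ℝ} (hf : ContinuousOn f (unitBall n)) {s : Set ℝ}
    (hs : IsClosed s) (h : ∀ᵐ z ∂ballVolume n, f z ∈ s) : ∀ z ∈ unitBall n, f z ∈ s := by
  intro z hz
  by_contra hzs
  have ho : IsOpen (unitBall n ∩ f ⁻¹' sᶜ) := hf.isOpen_inter_preimage Metric.isOpen_ball hs.isOpen_compl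
  refine (ballVolume_pos_of_isOpen ho ⟨z, hz, hzs⟩ Set.inter_subset_left).ne' ?_
  exact measure_mono_null (fun x hx => hx.2) h

theorem LogHolder.continuousOn (hp : LogHolder p) : ContinuousOn p (unitBall n) := by
  obtain ⟨C, hC, h⟩ := hp
  intro z hz
  rw [Metric.continuousWithinAt_iff]
  intro ε hε
  refine ⟨min (1 / 2) (Real.exp (-(C / ε))), by positivity, fun w hw hd => ?_⟩
  rw [dist_eq_norm] at hd
  obtain ⟨hd1, hd2⟩ := lt_min_iff.mp hd
  rcases eq_or_ne w z with rfl | hne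
  · simpa using hε
  have h0 : 0 < ‖w - z‖ := norm_pos_iff.mpr (sub_ne_zero.mpr hne)
  have hl : C / ε < Real.log (1 / ‖w - z‖) := by
    rw [one_div, Real.log_inv, lt_neg, Real.log_lt_iff_lt_exp h0]
    exact hd2
  have hl0 : 0 < C / ε := by positivity
  rw [Real.dist_eq]
  refine (h w hw z hz hd1).trans_lt ?_
  rw [div_lt_iff₀ (hl0.trans hl)]
  rw [div_lt_iff₀ hε] at hl
  linarith

theorem LogExponent.continuousOn (hp : LogExponent p) : ContinuousOn p (unitBall n) :=
  hp.1.continuousOn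

theorem LogExponent.exists_bounds (hp : LogExponent p) :
    ∃ P : ℝ, ∀ z ∈ unitBall n, 1 ≤ p z ∧ p z ≤ P := by
  obtain ⟨-, h1, -, h2⟩ := id hp
  obtain ⟨P, hP, -⟩ := EReal.lt_iff_exists_real_btwn.mp h2
  have ha : ∀ᵐ z ∂ballVolume n, p z ∈ Set.Ici 1 := by
    filter_upwards [ae_essInf_le (f := fun z => (p z : EReal)) (μ := ballVolume n)] with z hz
    exact_mod_cast (h1.le.trans hz)
  have hb : ∀ᵐ z ∂ballVolume n, p z ∈ Set.Iic P := by
    filter_upwards [ae_le_essSup (f := fun z => (p z : EReal)) (μ := ballVolume n)] with z hz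
    exact_mod_cast (hz.trans hP.le)
  exact ⟨P, fun z hz => ⟨forall_mem_unitBall_of_ae hp.continuousOn isClosed_Ici ha z hz,
    forall_mem_unitBall_of_ae hp.continuousOn isClosed_Iic hb z hz⟩⟩

/-- For small e, |z - w| is at most a fixed power of e, so log(1/e) is controlled by log(1/|z - w|).
For e bounded below both factors are bounded. The 1 + log keeps the factor positive at e = 1, so it
can be divided by. -/
theorem LogExponent.exists_osc_bound (hp : LogExponent p) :
    ∃ A : ℝ, 0 < A ∧ ∀ e : ℝ, 0 < e → e ≤ 1 → ∀ z ∈ unitBall n, ∀ w ∈ unitBall n,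
      ‖z - w‖ ^ 4 ≤ 256 * e → |p z - p w| * (1 + Real.log (1 / e)) ≤ A := by
  obtain ⟨P, hP⟩ := hp.exists_bounds
  obtain ⟨C, hC, h⟩ := hp.1
  have hP1 : 1 ≤ P := (hP 0 (by simp)).1.trans (hP 0 (by simp)).2
  refine ⟨9 * C + 17 * P, by positivity, fun e he he1 z hz w hw hzw => ?_⟩
  have hle : 0 ≤ Real.log (1 / e) := Real.log_nonneg ((one_le_div he).mpr he1)
  -- The threshold 2⁻¹⁶ makes (256e)² ≤ e, hence |z - w|⁸ ≤ e and |z - w| ≤ 1/4.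
  rcases le_or_gt e ((1 / 2) ^ 16) with h16 | h16
  · rcases eq_or_ne z w with rfl | hne
    · rw [sub_self, abs_zero, zero_mul]; positivity
    have h0 : 0 < ‖z - w‖ := norm_pos_iff.mpr (sub_ne_zero.mpr hne)
    have h8 : ‖z - w‖ ^ 8 ≤ e := by
      calc ‖z - w‖ ^ 8 = (‖z - w‖ ^ 4) ^ 2 := by ring
        _ ≤ (256 * e) ^ 2 := by gcongr
        _ = e * (2 ^ 16 * e) := by ring
        _ ≤ e * 1 := by gcongr; norm_num at h16 ⊢; linarith
        _ = e := mul_one e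
    have h4 : ‖z - w‖ ≤ 1 / 4 := by
      refine le_of_pow_le_pow_left₀ (n := 8) (by norm_num) (by norm_num) ?_
      norm_num at h16 ⊢; linarith
    have hl := h z hz w hw (by linarith)
    set l := Real.log (1 / ‖z - w‖) with hl'
    have hl8 : Real.log (1 / e) ≤ 8 * l := by
      rw [hl', ← Real.log_rpow (by positivity)]
      refine Real.log_le_log (by positivity) ?_
      rw [Real.div_rpow zero_le_one h0.le, Real.one_rpow]
      gcongr
      exact_mod_cast h8
    have hl1 : 1 ≤ l := by
      rw [hl', Real.le_log_iff_exp_le (by positivity), le_div_iff₀ h0]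
      have := Real.exp_one_lt_d9
      nlinarith [Real.exp_pos 1]
    calc |p z - p w| * (1 + Real.log (1 / e)) ≤ (C / l) * (9 * l) := by gcongr; linarith
      _ = 9 * C := by field_simp
      _ ≤ _ := by linarith
  · have h1 : |p z - p w| ≤ P := by
      rw [abs_le]
      constructor <;> linarith [hP z hz, hP w hw]
    have h2 : Real.log (1 / e) ≤ 16 := by
      rw [Real.log_le_iff_le_exp (by positivity)]
      have h3 : (2 : ℝ) ≤ Real.exp 1 := by linarith [Real.add_one_le_exp 1]
      have h4 : Real.exp 16 = Real.exp 1 ^ 16 := by rw [← Real.exp_nat_mul]; norm_num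
      rw [h4]
      calc 1 / e ≤ 2 ^ 16 := by
            rw [div_le_iff₀ he]; norm_num at h16 ⊢; linarith
        _ ≤ _ := by gcongr
    calc |p z - p w| * (1 + Real.log (1 / e)) ≤ P * (1 + 16) := by gcongr
      _ ≤ _ := by linarith

theorem one_div_rpow_le_exp {e x A : ℝ} (he : 0 < e) (hx : 0 ≤ x)
    (h : x * (1 + Real.log (1 / e)) ≤ A) : (1 / e) ^ x ≤ Real.exp A := by
  rw [Real.rpow_def_of_pos (by positivity), Real.exp_le_exp]
  linarith

theorem ofReal_norm_rpow {x : ℂ} {t : ℝ} (ht : 0 ≤ t) :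
    ENNReal.ofReal (‖x‖ ^ t) = ‖x‖ₑ ^ t := by
  rw [← ENNReal.ofReal_rpow_of_nonneg (norm_nonneg _) ht, ofReal_norm]

/-- Pointwise estimate of `|f(w)|^{p(w)}` by a local average of `1 + |f|^{p(·)}`. -/
theorem LogExponent.exists_point_estimate (hp : LogExponent p) :
    ∃ C : ℝ, 0 < C ∧ ∀ f : Cn n → ℂ, DifferentiableOn ℂ f (unitBall n) →
      modular p (ballVolume n) f ≤ 1 → ∀ w ∈ unitBall n,
      ENNReal.ofReal (‖f w‖ ^ p w) ≤ ENNReal.ofReal (C * dens w) *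
        ∫⁻ z in {z | Near w z}, (1 + ENNReal.ofReal (‖f z‖ ^ p z)) ∂ballVolume n := by
  obtain ⟨P, hP⟩ := hp.exists_bounds
  obtain ⟨A, hA, hosc⟩ := hp.exists_osc_bound
  have hP1 : 1 ≤ P := (hP 0 (by simp)).1.trans (hP 0 (by simp)).2
  set b : ℝ := 4 * 64 ^ n with hb
  have hb1 : 1 ≤ b := by
    have : (1 : ℝ) ≤ 64 ^ n := one_le_pow₀ (by norm_num)
    linarith
  have hb0 : 0 < b := by linarith
  refine ⟨b * ((2 * b) ^ P * Real.exp A ^ (n + 1)), by positivity, fun f hf hmod w hw => ?_⟩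
  unfold dens
  set e := 1 - ‖w‖ ^ 2 with he'
  have he : 0 < e := one_sub_sq_pos hw
  have he1 : e ≤ 1 := one_sub_sq_le_one w
  have hle : 0 ≤ Real.log (1 / e) := Real.log_nonneg ((one_le_div he).mpr he1)
  set I := ∫⁻ z in {z | Near w z}, (1 + ENNReal.ofReal (‖f z‖ ^ p z)) ∂ballVolume n with hI
  -- A constant exponent below p on all points near w, yet so close to p(w) that (1/e)^(p(w) - q)
  -- stays bounded.
  set q := max 1 (p w - A / (1 + Real.log (1 / e))) with hq
  have hq1 : 1 ≤ q := le_max_left _ _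
  have hq0 : 0 < q := by linarith
  have hqp : q ≤ p w := max_le (hP w hw).1 (by linarith [show 0 ≤ A / (1 + Real.log (1 / e)) by positivity])
  have hqz : ∀ z, Near w z → q ≤ p z := by
    intro z hz
    refine max_le (hP z hz.2.1).1 ?_
    have h1 := hosc e he he1 w hw z hz.2.1 hz.norm_sub_pow_le
    rw [← le_div_iff₀ (by positivity)] at h1
    linarith [le_abs_self (p w - p z)]
  have hqA : (1 / e) ^ (p w - q) ≤ Real.exp A := by
    refine one_div_rpow_le_exp he (by linarith) ?_
    rw [← le_div_iff₀ (by positivity)]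
    linarith [le_max_right 1 (p w - A / (1 + Real.log (1 / e)))]
  have hb' : ENNReal.ofReal (b⁻¹ * e ^ (n + 1)) * ENNReal.ofReal (b * (e ^ (n + 1))⁻¹) = 1 := by
    rw [← ENNReal.ofReal_mul (by positivity), ← ENNReal.ofReal_one]
    congr 1
    field_simp
  set J := ENNReal.ofReal (b * (e ^ (n + 1))⁻¹) * I with hJ
  have hmJ : ‖f w‖ₑ ^ q ≤ J := by
    have h1 := enorm_rpow_le_lintegral_near hf hw hq1
    have h2 : ∫⁻ z in {z | Near w z}, ‖f z‖ₑ ^ q ∂ballVolume n ≤ I := by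
      refine setLIntegral_mono' (measurableSet_near_left w) fun z hz => ?_
      rw [ofReal_norm_rpow (by linarith [hP z hz.2.1])]
      rcases le_total ‖f z‖ₑ 1 with h | h
      · exact (ENNReal.rpow_le_one h hq0.le).trans le_self_add
      · exact (ENNReal.rpow_le_rpow_of_exponent_le h (hqz z hz)).trans le_add_self
    calc ‖f w‖ₑ ^ q = ‖f w‖ₑ ^ q * (ENNReal.ofReal (b⁻¹ * e ^ (n + 1)) *
          ENNReal.ofReal (b * (e ^ (n + 1))⁻¹)) := by rw [hb', mul_one]
      _ ≤ I * ENNReal.ofReal (b * (e ^ (n + 1))⁻¹) := by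
          rw [← mul_assoc]; gcongr; exact h1.trans h2
      _ = J := mul_comm _ _
  have h1J : 1 ≤ J := by
    have h1 := enorm_rpow_le_lintegral_near (f := fun _ => (1 : ℂ)) (differentiableOn_const _) hw hq1
    simp only [enorm_one, ENNReal.one_rpow, one_mul] at h1
    have h2 : ∫⁻ z in {z | Near w z}, 1 ∂ballVolume n ≤ I :=
      lintegral_mono fun z => le_self_add
    rw [← hb', mul_comm (ENNReal.ofReal (b⁻¹ * e ^ (n + 1)))]
    rw [hJ]; gcongr; exact h1.trans h2
  have hI2 : I ≤ 2 := by
    calc I ≤ ∫⁻ z, (1 + ENNReal.ofReal (‖f z‖ ^ p z)) ∂ballVolume n := setLIntegral_le_lintegral _ _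
      _ = 1 + modular p (ballVolume n) f := by
          rw [lintegral_add_left measurable_const, modular, restrict_ballVolume]; simp
      _ ≤ 1 + 1 := by gcongr
      _ = 2 := one_add_one_eq_two
  have hJ2 : J ≤ ENNReal.ofReal (2 * b * (1 / e) ^ (n + 1)) := by
    calc J ≤ ENNReal.ofReal (b * (e ^ (n + 1))⁻¹) * 2 := by rw [hJ]; gcongr
      _ = _ := by
        rw [← ENNReal.ofReal_ofNat 2, ← ENNReal.ofReal_mul (by positivity)]
        congr 1
        rw [one_div, inv_pow]; ring
  have hJt : J ≠ ⊤ := ne_top_of_le_ne_top ENNReal.ofReal_ne_top hJ2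
  have hJ0 : J ≠ 0 := (zero_lt_one.trans_le h1J).ne'
  have hx0 : 0 ≤ p w - q := by linarith
  -- Raising |f(w)|^q ≤ J to the power p(w)/q leaves the excess J^(p(w)/q - 1). It is bounded
  -- because 1 ≤ J = O(e^-(n+1)), where the upper bound uses the modular hypothesis.
  have hJs : J ^ (p w / q - 1) ≤ ENNReal.ofReal ((2 * b) ^ P * Real.exp A ^ (n + 1)) := by
    have hs : p w / q - 1 ≤ p w - q := by
      rw [div_sub_one hq0.ne']
      exact div_le_self hx0 hq1
    calc J ^ (p w / q - 1) ≤ J ^ (p w - q) := ENNReal.rpow_le_rpow_of_exponent_le h1J hs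
      _ ≤ (ENNReal.ofReal (2 * b * (1 / e) ^ (n + 1))) ^ (p w - q) := ENNReal.rpow_le_rpow hJ2 hx0
      _ = ENNReal.ofReal ((2 * b) ^ (p w - q) * ((1 / e) ^ (p w - q)) ^ (n + 1)) := by
          rw [ENNReal.ofReal_rpow_of_nonneg (by positivity) hx0,
            Real.mul_rpow (by positivity) (by positivity), ← Real.rpow_natCast_mul (by positivity),
            ← Real.rpow_mul_natCast (by positivity), mul_comm (p w - q)]
      _ ≤ _ := by
          refine ENNReal.ofReal_le_ofReal ?_
          gcongr
          · linarith
          · linarith [(hP w hw).2]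
  calc ENNReal.ofReal (‖f w‖ ^ p w) = (‖f w‖ₑ ^ q) ^ (p w / q) := by
        rw [ofReal_norm_rpow (by linarith), ← ENNReal.rpow_mul, mul_div_cancel₀ _ hq0.ne']
    _ ≤ J ^ (p w / q) := ENNReal.rpow_le_rpow hmJ (div_nonneg (by linarith) hq0.le)
    _ = J * J ^ (p w / q - 1) := by
        conv_lhs => rw [show p w / q = 1 + (p w / q - 1) by ring,
          ENNReal.rpow_add _ _ hJ0 hJt, ENNReal.rpow_one]
    _ ≤ J * ENNReal.ofReal ((2 * b) ^ P * Real.exp A ^ (n + 1)) := by gcongr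
    _ = _ := by
        rw [hJ, mul_right_comm, ← ENNReal.ofReal_mul (by positivity)]
        congr 2
        ring

/-! ### Kernel integrals and test functions. -/

theorem ballVolume_norm_one_sub_lt_le {a : Cn n} (ha : a ∈ unitBall n) {s : ℝ} (hs : 0 < s) :
    ballVolume n {z ∈ unitBall n | ‖1 - inner ℂ a z‖ < s} ≤
      ENNReal.ofReal (4 * 25 ^ n * 4 ^ (n + 1) * s ^ (n + 1)) := by
  refine (ballVolume_le_smul _).trans ?_
  calc _ ≤ (volume (unitBall n))⁻¹ * (ENNReal.ofReal (4 * 25 ^ n * 4 ^ (n + 1) * s ^ (n + 1)) *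
        volume (unitBall n)) := by gcongr; exact volume_norm_one_sub_lt_le ha hs
    _ = _ := by
        rw [mul_left_comm, ENNReal.inv_mul_cancel volume_unitBall_pos.ne' volume_unitBall_ne_top,
          mul_one]

theorem measurableSet_norm_one_sub_lt (a : Cn n) (s : ℝ) :
    MeasurableSet {z ∈ unitBall n | ‖1 - inner ℂ a z‖ < s} :=
  have h : IsOpen {z : Cn n | ‖1 - inner ℂ a z‖ < s} := isOpen_lt (by fun_prop) continuous_const
  Metric.isOpen_ball.measurableSet.inter h.measurableSet

/-- A Forelli–Rudin type estimate, by dyadic decomposition of the ball. -/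
theorem lintegral_kernel_le {a : Cn n} (ha : a ∈ unitBall n) :
    ∫⁻ z in unitBall n, ENNReal.ofReal
      (dens a * ((1 - ‖a‖ ^ 2) / (2 * ‖1 - inner ℂ a z‖)) ^ (n + 2)) ∂ballVolume n ≤
      ENNReal.ofReal (2 * (4 * 25 ^ n * 4 ^ (n + 1))) := by
  have he := one_sub_sq_pos ha
  have hd := dens_pos ha
  set e := 1 - ‖a‖ ^ 2 with hee
  set B : ℝ := 4 * 25 ^ n * 4 ^ (n + 1) with hB
  have hB0 : 0 < B := by positivity
  let S : ℕ → Set (Cn n) := fun k => {z ∈ unitBall n | ‖1 - inner ℂ a z‖ < 2 ^ k * e}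
  have hS : ∀ k, MeasurableSet (S k) := fun k => measurableSet_norm_one_sub_lt a _
  let c : ℕ → ℝ≥0∞ := fun k => ENNReal.ofReal (dens a * ((1 / 2) ^ k) ^ (n + 2))
  have hpt : ∀ z ∈ unitBall n, ENNReal.ofReal (dens a * (e / (2 * ‖1 - inner ℂ a z‖)) ^ (n + 2)) ≤
      ∑' k, (S k).indicator (fun _ => c k) z := by
    intro z hz
    have hx := norm_one_sub_inner_pos ha hz
    have hx2 := one_sub_sq_le_norm (w := a) hz
    obtain ⟨k, hk1, hk2⟩ := exists_nat_pow_near_of_lt_one (x := e / (2 * ‖1 - inner ℂ a z‖))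
      (y := 1 / 2) (by positivity) (by rw [div_le_one (by positivity)]; exact hx2)
      (by norm_num) (by norm_num)
    refine le_trans ?_ (ENNReal.le_tsum k)
    rw [Set.indicator_of_mem]
    · refine ENNReal.ofReal_le_ofReal ?_
      gcongr
    · refine ⟨hz, ?_⟩
      rw [lt_div_iff₀ (by positivity), pow_succ, one_div, inv_pow] at hk1
      have h2 : (0 : ℝ) < 2 ^ k := by positivity
      calc ‖1 - inner ℂ a z‖ = 2 ^ k * (((2 : ℝ) ^ k)⁻¹ * 2⁻¹ * (2 * ‖1 - inner ℂ a z‖)) := by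
            field_simp
        _ < 2 ^ k * e := by gcongr
  -- The kernel decays like 2^(-k(n+2)) while the volume grows like 2^(k(n+1)), leaving a geometric
  -- series.
  have hterm : ∀ k, c k * ballVolume n (S k) ≤ ENNReal.ofReal (B * (1 / 2) ^ k) := by
    intro k
    calc c k * ballVolume n (S k) ≤ c k * ENNReal.ofReal (B * (2 ^ k * e) ^ (n + 1)) := by
          gcongr; exact ballVolume_norm_one_sub_lt_le ha (by positivity)
      _ = ENNReal.ofReal (B * (1 / 2) ^ k) := by
          rw [← ENNReal.ofReal_mul (by positivity)]
          congr 1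
          rw [dens, ← hee, mul_pow, one_div, inv_pow, pow_succ (((2 : ℝ) ^ k)⁻¹) (n + 1), inv_pow]
          field_simp
  calc _ ≤ ∫⁻ z in unitBall n, ∑' k, (S k).indicator (fun _ => c k) z ∂ballVolume n :=
        setLIntegral_mono' Metric.isOpen_ball.measurableSet hpt
    _ = ∑' k, c k * ballVolume n (S k) := by
        rw [restrict_ballVolume, lintegral_tsum fun k => (measurable_const.indicator (hS k)).aemeasurable]
        refine tsum_congr fun k => ?_
        rw [lintegral_indicator (hS k), setLIntegral_const]
    _ ≤ ∑' k, ENNReal.ofReal (B * (1 / 2) ^ k) := ENNReal.tsum_le_tsum hterm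
    _ = _ := by
        rw [← ENNReal.ofReal_tsum_of_nonneg (fun k => by positivity)
          (summable_geometric_two.mul_left B), tsum_mul_left, tsum_geometric_two, mul_comm]

/-- Normalized test functions concentrated near the point `a`. -/
noncomputable def testFn (p : Cn n → ℝ) (M : ℕ) (a z : Cn n) : ℂ :=
  ((dens a ^ (1 / p a) : ℝ) : ℂ) * (((1 - ‖a‖ ^ 2 : ℝ) : ℂ) / (1 - inner ℂ a z)) ^ M

theorem differentiableOn_testFn (M : ℕ) {a : Cn n} (ha : a ∈ unitBall n) :
    DifferentiableOn ℂ (testFn p M a) (unitBall n) := by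
  have h : Differentiable ℂ fun z : Cn n => inner ℂ a z := (innerSL ℂ a : Cn n →L[ℂ] ℂ).differentiable
  unfold testFn
  simp only [div_eq_mul_inv]
  refine (((((differentiableOn_const 1).sub h.differentiableOn).fun_inv ?_).const_mul _).fun_pow M).const_mul _
  exact fun z hz => one_sub_inner_ne_zero ha hz

theorem norm_testFn (M : ℕ) {a : Cn n} (ha : a ∈ unitBall n) (z : Cn n) :
    ‖testFn p M a z‖ = dens a ^ (1 / p a) * ((1 - ‖a‖ ^ 2) / ‖1 - inner ℂ a z‖) ^ M := by
  have he := one_sub_sq_pos ha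
  have hd := dens_pos ha
  rw [testFn, norm_mul, norm_pow, norm_div, Complex.norm_real, Complex.norm_real, Real.norm_eq_abs,
    Real.norm_eq_abs, abs_of_pos he, abs_of_pos (Real.rpow_pos_of_pos hd _)]

theorem norm_testFn_self (M : ℕ) {a : Cn n} (ha : a ∈ unitBall n) :
    ‖testFn p M a a‖ = dens a ^ (1 / p a) := by
  have he := one_sub_sq_pos ha
  have : (1 : ℂ) - inner ℂ a a = ((1 - ‖a‖ ^ 2 : ℝ) : ℂ) := by
    rw [inner_self_eq_norm_sq_to_K]; push_cast; rfl
  rw [norm_testFn M ha, this, Complex.norm_real, Real.norm_eq_abs, abs_of_pos he, div_self he.ne',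
    one_pow, mul_one]

theorem LogExponent.exists_modular_testFn_le (hp : LogExponent p) :
    ∃ (M : ℕ) (K : ℝ), 1 ≤ K ∧ ∀ a ∈ unitBall n,
      modular p (ballVolume n) (testFn p M a) ≤ ENNReal.ofReal K := by
  obtain ⟨P, hP⟩ := hp.exists_bounds
  obtain ⟨A, hA, hosc⟩ := hp.exists_osc_bound
  have hP1 : 1 ≤ P := (hP 0 (by simp)).1.trans (hP 0 (by simp)).2
  obtain ⟨N, hN⟩ := exists_nat_ge (2 * (n + 1) * P)
  -- The n + 2 powers feed the kernel integral; the other N absorb the variation of the exponent far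
  -- from a.
  set M := N + (n + 2) with hM
  set D : ℝ := 2 ^ (M * P) * Real.exp A ^ (n + 1) with hD
  have hD0 : 0 < D := by positivity
  refine ⟨M, max 1 (D * (2 * (4 * 25 ^ n * 4 ^ (n + 1)))), le_max_left _ _, fun a ha => ?_⟩
  have hexp1 : 1 ≤ Real.exp A := Real.one_le_exp hA.le
  have he := one_sub_sq_pos ha
  have he1 := one_sub_sq_le_one a
  have hd := dens_pos ha
  have hpt : ∀ z ∈ unitBall n, ENNReal.ofReal (‖testFn p M a z‖ ^ p z) ≤
      ENNReal.ofReal D * ENNReal.ofReal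
        (dens a * ((1 - ‖a‖ ^ 2) / (2 * ‖1 - inner ℂ a z‖)) ^ (n + 2)) := by
    intro z hz
    rw [← ENNReal.ofReal_mul hD0.le]
    refine ENNReal.ofReal_le_ofReal ?_
    rw [norm_testFn M ha]
    have hx := norm_one_sub_inner_pos ha hz
    have hx2 := one_sub_sq_le_norm (w := a) hz
    have hdist := norm_sub_sq_le ha hz
    set e := 1 - ‖a‖ ^ 2 with hee
    set x := ‖1 - inner ℂ a z‖ with hxx
    set s := e / (2 * x) with hs
    have hs0 : 0 < s := by positivity
    have hs1 : s ≤ 1 := by rw [hs, div_le_one (by positivity)]; exact hx2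
    have hst : e / x = 2 * s := by rw [hs]; field_simp
    obtain ⟨hz1, hzP⟩ := hP z hz
    obtain ⟨ha1, haP⟩ := hP a ha
    have hpa : 0 < p a := by linarith
    have h1e : 1 ≤ 1 / e := (one_le_div he).mpr he1
    have hosc' : ((1 / e) ^ (p z / p a - 1)) ^ (n + 1) * s ^ N ≤ Real.exp A ^ (n + 1) := by
      -- If x² ≤ e, then z is close enough to a for the oscillation bound. Otherwise 1/e ≤ s⁻², and
      -- s^N outweighs the crude bound (1/e)^((n+1)P).
      rcases le_or_gt e ((e / x) ^ 2) with h | h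
      · have h4 : ‖z - a‖ ^ 4 ≤ 256 * e := by
          rw [norm_sub_rev]
          have hxe : x ^ 2 ≤ e := by
            rw [div_pow, le_div_iff₀ (by positivity)] at h
            nlinarith
          calc ‖a - z‖ ^ 4 = (‖a - z‖ ^ 2) ^ 2 := by ring
            _ ≤ (2 * x) ^ 2 := by gcongr
            _ ≤ _ := by nlinarith
        have h5 := one_div_rpow_le_exp he (abs_nonneg _) (hosc e he he1 z hz a ha h4)
        have h6 : p z / p a - 1 ≤ |p z - p a| := by
          rw [div_sub_one hpa.ne']
          calc (p z - p a) / p a ≤ |p z - p a| / p a := by gcongr; exact le_abs_self _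
            _ ≤ |p z - p a| := div_le_self (abs_nonneg _) ha1
        calc ((1 / e) ^ (p z / p a - 1)) ^ (n + 1) * s ^ N ≤ Real.exp A ^ (n + 1) * 1 := by
              gcongr
              · exact (Real.rpow_le_rpow_of_exponent_le h1e h6).trans h5
              · exact pow_le_one₀ hs0.le hs1
          _ = _ := mul_one _
      · have h6 : p z / p a - 1 ≤ P := by
          rw [div_sub_one hpa.ne']
          refine (div_le_iff₀ hpa).mpr ?_
          nlinarith
        have h7 : 1 / e ≤ (s ^ 2)⁻¹ := by
          rw [one_div]
          refine inv_anti₀ (by positivity) ?_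
          rw [hst] at h
          nlinarith
        have h8 : ((1 / e) ^ (p z / p a - 1)) ^ (n + 1) ≤ (s ^ N)⁻¹ := by
          calc ((1 / e) ^ (p z / p a - 1)) ^ (n + 1) ≤ ((1 / e) ^ P) ^ (n + 1) := by gcongr
            _ ≤ (((s ^ 2)⁻¹) ^ P) ^ (n + 1) := by gcongr
            _ = (s⁻¹) ^ (2 * (n + 1) * P) := by
                rw [← inv_pow, ← Real.rpow_natCast, ← Real.rpow_mul (by positivity),
                  ← Real.rpow_natCast, ← Real.rpow_mul (by positivity)]
                push_cast; ring_nf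
            _ ≤ (s⁻¹) ^ (N : ℝ) := Real.rpow_le_rpow_of_exponent_le ((one_le_inv₀ hs0).mpr hs1) hN
            _ = (s ^ N)⁻¹ := by rw [Real.rpow_natCast, inv_pow]
        calc ((1 / e) ^ (p z / p a - 1)) ^ (n + 1) * s ^ N ≤ (s ^ N)⁻¹ * s ^ N := by gcongr
          _ = 1 := inv_mul_cancel₀ (by positivity)
          _ ≤ _ := one_le_pow₀ hexp1
    have hden : (dens a ^ (1 / p a)) ^ p z = dens a * ((1 / e) ^ (p z / p a - 1)) ^ (n + 1) := by
      rw [← dens_rpow ha, ← Real.rpow_mul hd.le]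
      conv_rhs => rw [← Real.rpow_one_add' hd.le (by
        rw [add_sub_cancel]; exact (div_pos (by linarith) hpa).ne')]
      congr 1; ring
    have hker : ((e / x) ^ M) ^ p z ≤ 2 ^ (M * P) * (s ^ N * s ^ (n + 2)) := by
      rw [hst, mul_pow, Real.mul_rpow (by positivity) (by positivity), ← pow_add, ← hM]
      gcongr
      · rw [← Real.rpow_natCast, ← Real.rpow_mul (by norm_num)]
        exact Real.rpow_le_rpow_of_exponent_le (by norm_num) (by gcongr)
      · exact Real.rpow_le_self_of_le_one (by positivity) (pow_le_one₀ hs0.le hs1) hz1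
    calc (dens a ^ (1 / p a) * (e / x) ^ M) ^ p z
        = dens a * ((1 / e) ^ (p z / p a - 1)) ^ (n + 1) * ((e / x) ^ M) ^ p z := by
          rw [Real.mul_rpow (by positivity) (by positivity), hden]
      _ ≤ dens a * ((1 / e) ^ (p z / p a - 1)) ^ (n + 1) *
          (2 ^ (M * P) * (s ^ N * s ^ (n + 2))) := by gcongr
      _ = dens a * (((1 / e) ^ (p z / p a - 1)) ^ (n + 1) * s ^ N) * (2 ^ (M * P) * s ^ (n + 2)) := by
          ring
      _ ≤ dens a * Real.exp A ^ (n + 1) * (2 ^ (M * P) * s ^ (n + 2)) := by gcongr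
      _ = D * (dens a * s ^ (n + 2)) := by rw [hD]; ring
  calc modular p (ballVolume n) (testFn p M a)
      ≤ ∫⁻ z in unitBall n, ENNReal.ofReal D * ENNReal.ofReal
        (dens a * ((1 - ‖a‖ ^ 2) / (2 * ‖1 - inner ℂ a z‖)) ^ (n + 2)) ∂ballVolume n :=
        setLIntegral_mono' Metric.isOpen_ball.measurableSet hpt
    _ ≤ ENNReal.ofReal D * ENNReal.ofReal (2 * (4 * 25 ^ n * 4 ^ (n + 1))) := by
        rw [lintegral_const_mul' _ _ ENNReal.ofReal_ne_top]
        gcongr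
        exact lintegral_kernel_le ha
    _ ≤ _ := by
        rw [← ENNReal.ofReal_mul hD0.le]
        exact ENNReal.ofReal_le_ofReal (le_max_right _ _)

theorem LogExponent.exists_dens_rpow_le_norm_testFn (hp : LogExponent p) (M : ℕ) :
    ∃ C : ℝ, 1 ≤ C ∧ ∀ a w : Cn n, Near a w → dens w ^ (1 / p w) ≤ C * ‖testFn p M a w‖ := by
  obtain ⟨P, hP⟩ := hp.exists_bounds
  obtain ⟨A, hA, hosc⟩ := hp.exists_osc_bound
  refine ⟨16 ^ (n + 1) * Real.exp A ^ (n + 1) * 8 ^ M, ?_, fun a w haw => ?_⟩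
  · exact one_le_mul_of_one_le_of_one_le (one_le_mul_of_one_le_of_one_le
      (one_le_pow₀ (by norm_num)) (one_le_pow₀ (Real.one_le_exp hA.le))) (one_le_pow₀ (by norm_num))
  have ha := haw.1
  have hw := haw.2.1
  have he := one_sub_sq_pos ha
  have hew := one_sub_sq_pos hw
  have he1 := one_sub_sq_le_one a
  have hd := dens_pos ha
  have hdw := dens_pos hw
  obtain ⟨hw1, -⟩ := hP w hw
  obtain ⟨ha1, -⟩ := hP a ha
  have hx := norm_one_sub_inner_pos ha hw
  have h1e : 1 ≤ 1 / (1 - ‖a‖ ^ 2) := (one_le_div he).mpr he1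
  have ht : 1 ≤ 8 ^ M * ((1 - ‖a‖ ^ 2) / ‖1 - inner ℂ a w‖) ^ M := by
    have h := haw.symm.norm_one_sub_inner_le
    rw [norm_one_sub_inner_symm] at h
    rw [← mul_pow]
    refine one_le_pow₀ ?_
    rw [← mul_div_assoc, one_le_div hx]
    exact h
  have h16 : dens w ≤ 16 ^ (n + 1) * dens a := by
    have h := haw.one_sub_sq_le
    rw [dens, dens, ← inv_pow, ← inv_pow, ← mul_pow]
    gcongr
    rw [inv_le_iff_one_le_mul₀ hew]
    calc (1 : ℝ) = (1 - ‖a‖ ^ 2)⁻¹ * (1 - ‖a‖ ^ 2) := (inv_mul_cancel₀ he.ne').symm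
      _ ≤ (1 - ‖a‖ ^ 2)⁻¹ * (16 * (1 - ‖w‖ ^ 2)) := by gcongr
      _ = _ := by ring
  have hosc' : dens a ^ (1 / p w) ≤ Real.exp A ^ (n + 1) * dens a ^ (1 / p a) := by
    have h1 : dens a ^ (1 / p w) = dens a ^ (1 / p w - 1 / p a) * dens a ^ (1 / p a) := by
      rw [← Real.rpow_add hd, sub_add_cancel]
    rw [h1, dens_rpow ha (1 / p w - 1 / p a)]
    gcongr
    refine (Real.rpow_le_rpow_of_exponent_le h1e ?_).trans (one_div_rpow_le_exp he (abs_nonneg _)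
      (hosc _ he he1 a ha w hw haw.norm_sub_pow_le))
    rw [div_sub_div _ _ (by linarith) (by linarith), one_mul, mul_one]
    calc (p a - p w) / (p w * p a) ≤ |p a - p w| / (p w * p a) := by gcongr; exact le_abs_self _
      _ ≤ |p a - p w| := div_le_self (abs_nonneg _) (one_le_mul_of_one_le_of_one_le hw1 ha1)
  have hpw : 1 / p w ≤ 1 := by rw [div_le_one (by linarith)]; exact hw1
  have hpw0 : 0 ≤ 1 / p w := by positivity
  calc dens w ^ (1 / p w) ≤ (16 ^ (n + 1) * dens a) ^ (1 / p w) := by gcongr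
    _ = ((16 : ℝ) ^ (n + 1)) ^ (1 / p w) * dens a ^ (1 / p w) := Real.mul_rpow (by positivity) hd.le
    _ ≤ 16 ^ (n + 1) * (Real.exp A ^ (n + 1) * dens a ^ (1 / p a)) := by
        gcongr
        exact Real.rpow_le_self_of_one_le (one_le_pow₀ (by norm_num)) hpw
    _ = 16 ^ (n + 1) * Real.exp A ^ (n + 1) * dens a ^ (1 / p a) * 1 := by ring
    _ ≤ 16 ^ (n + 1) * Real.exp A ^ (n + 1) * dens a ^ (1 / p a) *
        (8 ^ M * ((1 - ‖a‖ ^ 2) / ‖1 - inner ℂ a w‖) ^ M) := by gcongr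
    _ = _ := by rw [norm_testFn M ha]; ring

/-! ### Passing between modulars and Luxemburg norms. -/

theorem _root_.DifferentiableOn.div_ofReal {f : Cn n → ℂ} {s : Set (Cn n)}
    (hf : DifferentiableOn ℂ f s) (c : ℝ) : DifferentiableOn ℂ (fun z => f z / (c : ℂ)) s := by
  simp only [div_eq_mul_inv]
  exact hf.mul_const _

theorem modular_div_le_one {μ : Measure (Cn n)} {f : Cn n → ℂ} (hp : ∀ z ∈ unitBall n, 1 ≤ p z)
    {K : ℝ} (hK : 1 ≤ K) (h : modular p μ f ≤ ENNReal.ofReal K) :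
    modular p μ (fun z => f z / (K : ℂ)) ≤ 1 := by
  have hK0 : 0 < K := by linarith
  calc modular p μ (fun z => f z / (K : ℂ))
      ≤ ∫⁻ z in unitBall n, ENNReal.ofReal K⁻¹ * ENNReal.ofReal (‖f z‖ ^ p z) ∂μ := by
        refine setLIntegral_mono' Metric.isOpen_ball.measurableSet fun z hz => ?_
        rw [← ENNReal.ofReal_mul (by positivity)]
        refine ENNReal.ofReal_le_ofReal ?_
        rw [norm_div, Complex.norm_real, Real.norm_eq_abs, abs_of_pos hK0,
          Real.div_rpow (norm_nonneg _) hK0.le, div_eq_inv_mul]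
        gcongr
        exact Real.self_le_rpow_of_one_le hK (hp z hz)
    _ = ENNReal.ofReal K⁻¹ * modular p μ f := lintegral_const_mul' _ _ ENNReal.ofReal_ne_top
    _ ≤ ENNReal.ofReal K⁻¹ * ENNReal.ofReal K := by gcongr
    _ = 1 := by
        rw [← ENNReal.ofReal_mul (by positivity), inv_mul_cancel₀ hK0.ne', ENNReal.ofReal_one]

theorem luxNorm_le_of_modular_div_le_one {μ : Measure (Cn n)} {f : Cn n → ℂ} {γ : ℝ} (hγ : 0 < γ)
    (h : modular p μ (fun z => f z / (γ : ℂ)) ≤ 1) : luxNorm p μ f ≤ ENNReal.ofReal γ :=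
  sInf_le ⟨γ, hγ, rfl, h⟩

theorem modular_div_le_one_of_luxNorm_lt {μ : Measure (Cn n)} {f : Cn n → ℂ}
    (hp : ∀ z ∈ unitBall n, 1 ≤ p z) {L : ℝ} (h : luxNorm p μ f < ENNReal.ofReal L) :
    modular p μ (fun z => f z / (L : ℂ)) ≤ 1 := by
  obtain ⟨_, ⟨γ, hγ, rfl, hmod⟩, hlt⟩ := sInf_lt_iff.mp h
  have hγL : γ < L := (ENNReal.ofReal_lt_ofReal_iff_of_nonneg hγ.le).mp hlt
  refine le_trans (setLIntegral_mono' Metric.isOpen_ball.measurableSet fun z hz => ?_) hmod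
  refine ENNReal.ofReal_le_ofReal (Real.rpow_le_rpow (norm_nonneg _) ?_ (by linarith [hp z hz]))
  rw [norm_div, norm_div, Complex.norm_real, Complex.norm_real, Real.norm_eq_abs, Real.norm_eq_abs,
    abs_of_pos hγ, abs_of_pos (hγ.trans hγL)]
  gcongr

/-- By homogeneity it suffices to treat f/γ for each admissible γ, and a modular bound K ≥ 1 yields
a norm bound K because p ≥ 1. -/
theorem isCarleson_of_modular_le {μ : Measure (Cn n)} (hp : ∀ z ∈ unitBall n, 1 ≤ p z)
    {K : ℝ} (hK : 1 ≤ K) (h : ∀ f : Cn n → ℂ, DifferentiableOn ℂ f (unitBall n) →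
      modular p (ballVolume n) f ≤ 1 → modular p μ f ≤ ENNReal.ofReal K) : IsCarleson p μ := by
  have hK0 : 0 < K := by linarith
  refine ⟨K, hK0, fun f hf => ?_⟩
  rw [mul_comm, ← ENNReal.div_le_iff_le_mul (Or.inl (ENNReal.ofReal_pos.mpr hK0).ne')
    (Or.inl ENNReal.ofReal_ne_top)]
  refine le_sInf ?_
  rintro _ ⟨γ, hγ, rfl, hmod⟩
  rw [ENNReal.div_le_iff_le_mul (Or.inl (ENNReal.ofReal_pos.mpr hK0).ne')
    (Or.inl ENNReal.ofReal_ne_top), ← ENNReal.ofReal_mul hγ.le]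
  refine luxNorm_le_of_modular_div_le_one (by positivity) ?_
  have := modular_div_le_one hp hK (h _ (hf.1.div_ofReal γ) hmod)
  simpa only [div_div, ← Complex.ofReal_mul] using this

theorem WCompBounded.exists_modular_le {u : Cn n → ℂ} {φ : Cn n → Cn n}
    (hp : ∀ z ∈ unitBall n, 1 ≤ p z) (hC : WCompBounded p u φ) {K : ℝ} (hK : 1 ≤ K) :
    ∃ L : ℝ, 1 ≤ L ∧ ∀ f, DifferentiableOn ℂ f (unitBall n) →
      modular p (ballVolume n) f ≤ ENNReal.ofReal K →
      DifferentiableOn ℂ (fun z => wComp u φ f z / (L : ℂ)) (unitBall n) ∧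
      modular p (ballVolume n) (fun z => wComp u φ f z / (L : ℂ)) ≤ 1 := by
  obtain ⟨C, hC0, hC⟩ := hC
  have hK0 : 0 < K := by linarith
  have hCK : 0 < C * K := by positivity
  -- The added 1 makes the norm strictly smaller, so attainment of the infimum is not needed.
  refine ⟨C * K + 1, by linarith, fun f hf hmod => ?_⟩
  obtain ⟨h1, h2⟩ := hC f ⟨hf, hmod.trans_lt ENNReal.ofReal_lt_top⟩
  refine ⟨h1.1.div_ofReal _, modular_div_le_one_of_luxNorm_lt hp ?_⟩
  calc luxNorm p (ballVolume n) (wComp u φ f)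
      ≤ ENNReal.ofReal C * luxNorm p (ballVolume n) f := h2
    _ ≤ ENNReal.ofReal C * ENNReal.ofReal K := by
        gcongr
        exact luxNorm_le_of_modular_div_le_one hK0 (modular_div_le_one hp hK hmod)
    _ = ENNReal.ofReal (C * K) := (ENNReal.ofReal_mul hC0.le).symm
    _ < ENNReal.ofReal (C * K + 1) := (ENNReal.ofReal_lt_ofReal_iff (by linarith)).mpr (by linarith)

theorem lintegral_one_add_le_two {f : Cn n → ℂ} (h : modular p (ballVolume n) f ≤ 1) :
    ∫⁻ z, (1 + ENNReal.ofReal (‖f z‖ ^ p z)) ∂ballVolume n ≤ 2 := by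
  rw [lintegral_add_left measurable_const, lintegral_const, measure_univ, one_mul]
  rw [modular, restrict_ballVolume] at h
  exact (add_le_add_right h 1).trans_eq one_add_one_eq_two

/-! ### The pointwise bound (i). -/

theorem one_sub_sq_rpow_div {w : Cn n} (hw : w ∈ unitBall n) (t : ℝ) :
    (1 - ‖w‖ ^ 2) ^ (((n : ℝ) + 1) / t) = (dens w ^ (1 / t))⁻¹ := by
  have he := one_sub_sq_pos hw
  rw [dens, Real.inv_rpow (by positivity), inv_inv, ← Real.rpow_natCast _ (n + 1), ← Real.rpow_mul he.le]
  congr 1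
  push_cast
  ring

theorem bddAbove_of_wCompBounded (hp : LogExponent p) {u : Cn n → ℂ} {φ : Cn n → Cn n}
    (hφ_self : Set.MapsTo φ (unitBall n) (unitBall n)) (hC : WCompBounded p u φ) :
    BddAbove ((fun z : Cn n => ‖u z‖ * ((1 - ‖z‖ ^ 2) ^ (((n : ℝ) + 1) / p z) /
      (1 - ‖φ z‖ ^ 2) ^ (((n : ℝ) + 1) / p (φ z)))) '' unitBall n) := by
  obtain ⟨P, hP⟩ := hp.exists_bounds
  have hp1 : ∀ z ∈ unitBall n, 1 ≤ p z := fun z hz => (hP z hz).1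
  obtain ⟨M, K, hK, hmod⟩ := hp.exists_modular_testFn_le
  obtain ⟨L, hL, hT⟩ := hC.exists_modular_le hp1 hK
  obtain ⟨C, hC0, hpt⟩ := hp.exists_point_estimate
  have hL0 : 0 < L := by linarith
  refine ⟨max 1 (C * 2) * L, ?_⟩
  rintro _ ⟨z, hz, rfl⟩
  have hw := hφ_self hz
  set w := φ z with hwz
  have hdz := dens_pos hz
  have hdw := dens_pos hw
  have hpz := hp1 z hz
  obtain ⟨hd, hm⟩ := hT _ (differentiableOn_testFn M hw) (hmod w hw)
  set g : Cn n → ℂ := fun z => wComp u φ (testFn p M w) z / (L : ℂ) with hg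
  have h1 : ENNReal.ofReal (‖g z‖ ^ p z) ≤ ENNReal.ofReal (C * 2 * dens z) := by
    refine (hpt g hd hm z hz).trans ?_
    rw [show C * 2 * dens z = C * dens z * 2 by ring, ENNReal.ofReal_mul (p := C * dens z) (by positivity),
      ENNReal.ofReal_ofNat]
    gcongr
    exact (setLIntegral_le_lintegral _ _).trans (lintegral_one_add_le_two hm)
  rw [ENNReal.ofReal_le_ofReal_iff (by positivity)] at h1
  have h2 : ‖g z‖ ≤ max 1 (C * 2) * dens z ^ (1 / p z) := by
    have hm1 : 1 ≤ max 1 (C * 2) := le_max_left _ _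
    calc ‖g z‖ = (‖g z‖ ^ p z) ^ (1 / p z) := by
          rw [← Real.rpow_mul (norm_nonneg _), mul_one_div_cancel (by linarith), Real.rpow_one]
      _ ≤ (max 1 (C * 2) * dens z) ^ (1 / p z) := by
          refine Real.rpow_le_rpow (by positivity) (h1.trans ?_) (by positivity)
          gcongr
          exact le_max_right _ _
      _ = (max 1 (C * 2)) ^ (1 / p z) * dens z ^ (1 / p z) := Real.mul_rpow (by positivity) hdz.le
      _ ≤ _ := by
          gcongr
          refine Real.rpow_le_self_of_one_le hm1 ?_
          rw [div_le_one (by linarith)]; exact hpz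
  have h3 : ‖g z‖ = ‖u z‖ * dens w ^ (1 / p w) / L := by
    rw [hg]
    simp only [wComp, norm_div, norm_mul, Complex.norm_real, Real.norm_eq_abs, abs_of_pos hL0,
      ← hwz, norm_testFn_self M hw]
  rw [h3, div_le_iff₀ hL0] at h2
  change ‖u z‖ * ((1 - ‖z‖ ^ 2) ^ (((n : ℝ) + 1) / p z) / (1 - ‖w‖ ^ 2) ^ (((n : ℝ) + 1) / p w)) ≤ _
  rw [one_sub_sq_rpow_div hz, one_sub_sq_rpow_div hw, div_inv_eq_mul, mul_left_comm,
    inv_mul_le_iff₀ (by positivity)]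
  linarith

/-! ### The Carleson property (ii). -/

theorem aemeasurable_ballVolume {β : Type*} [TopologicalSpace β] [MeasurableSpace β] [BorelSpace β]
    {f : Cn n → β} (hf : ContinuousOn f (unitBall n)) : AEMeasurable f (ballVolume n) :=
  (hf.aemeasurable Metric.isOpen_ball.measurableSet).smul_measure _

/-- Only the upper bound is needed, which spares any measurability of H. -/
theorem lintegral_pullbackMeasure_le {u : Cn n → ℂ} {φ : Cn n → Cn n}
    (hw : AEMeasurable (fun z => ENNReal.ofReal (‖u z‖ ^ p z * omegaWeight p φ z)) (ballVolume n))
    (H : Cn n → ℝ≥0∞) :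
    ∫⁻ w, H w ∂pullbackMeasure p u φ ≤
      ∫⁻ z, ENNReal.ofReal (‖u z‖ ^ p z * omegaWeight p φ z) * H (φ z) ∂ballVolume n := by
  refine (lintegral_map_le _ _).trans ?_
  rw [withDensity_congr_ae hw.ae_eq_mk]
  refine (lintegral_withDensity_le_lintegral_mul _ hw.measurable_mk _).trans_eq ?_
  refine lintegral_congr_ae ?_
  filter_upwards [hw.ae_eq_mk] with z hz
  rw [Pi.mul_apply, ← hz]

theorem omegaWeight_mul_dens {φ : Cn n → Cn n} {z : Cn n} (hz : φ z ∈ unitBall n)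
    (hpz : 0 < p z) (hp : 0 < p (φ z)) :
    omegaWeight p φ z * dens (φ z) = (dens (φ z) ^ (1 / p (φ z))) ^ p z := by
  have he := one_sub_sq_pos hz
  have hd := dens_pos hz
  have h : omegaWeight p φ z = dens (φ z) ^ ((p z - p (φ z)) / p (φ z)) := by
    rw [dens_rpow hz, omegaWeight, ← Real.rpow_mul_natCast (by positivity)]
    congr 1
    push_cast
    ring
  rw [h, ← Real.rpow_mul hd.le, sub_div, div_self hp.ne', mul_comm,
    ← Real.rpow_one_add' hd.le (by rw [add_sub_cancel]; positivity), add_sub_cancel, one_div_mul_eq_div]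

theorem continuousOn_omegaWeight (hp : ContinuousOn p (unitBall n))
    (hp1 : ∀ z ∈ unitBall n, 1 ≤ p z) {φ : Cn n → Cn n} (hφ : ContinuousOn φ (unitBall n))
    (hφ_self : Set.MapsTo φ (unitBall n) (unitBall n)) :
    ContinuousOn (omegaWeight p φ) (unitBall n) := by
  have hpφ : ContinuousOn (fun z => p (φ z)) (unitBall n) := hp.comp hφ hφ_self
  have hb : ∀ z ∈ unitBall n, 0 < 1 - ‖φ z‖ ^ 2 := fun z hz => one_sub_sq_pos (hφ_self hz)
  refine ContinuousOn.rpow ?_ ?_ fun z hz => Or.inl (one_div_pos.mpr (hb z hz)).ne'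
  · exact continuousOn_const.div (continuousOn_const.sub (hφ.norm.pow 2)) fun z hz => (hb z hz).ne'
  · refine continuousOn_const.mul ((hp.sub hpφ).div hpφ fun z hz => ?_)
    linarith [hp1 _ (hφ_self hz)]

theorem continuousOn_norm_rpow (hp : ContinuousOn p (unitBall n))
    (hp1 : ∀ z ∈ unitBall n, 1 ≤ p z) {f : Cn n → ℂ} (hf : ContinuousOn f (unitBall n)) :
    ContinuousOn (fun z => ‖f z‖ ^ p z) (unitBall n) :=
  hf.norm.rpow hp fun z hz => Or.inr (by linarith [hp1 z hz])

/-- The indicator function of the relation `Near`. -/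
noncomputable def nearIndicator (x : Cn n × Cn n) : ℝ≥0∞ :=
  open Classical in if Near x.1 x.2 then 1 else 0

theorem measurable_nearIndicator : Measurable (nearIndicator (n := n)) :=
  Measurable.ite measurableSet_near measurable_const measurable_const

theorem nearIndicator_of_near {w z : Cn n} (h : Near w z) : nearIndicator (w, z) = 1 :=
  if_pos h

theorem nearIndicator_of_not_near {w z : Cn n} (h : ¬ Near w z) : nearIndicator (w, z) = 0 :=
  if_neg h

theorem LogExponent.one_le (hp : LogExponent p) : ∀ z ∈ unitBall n, 1 ≤ p z := by
  obtain ⟨P, hP⟩ := hp.exists_bounds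
  exact fun z hz => (hP z hz).1

/-- The geometric Carleson condition for `μ_{u,φ}`, obtained by testing on `testFn`. -/
theorem LogExponent.exists_lintegral_near_le (hp : LogExponent p) {u : Cn n → ℂ}
    {φ : Cn n → Cn n} (hφ_self : Set.MapsTo φ (unitBall n) (unitBall n))
    (hC : WCompBounded p u φ) :
    ∃ B : ℝ, 0 < B ∧ ∀ ζ, ∫⁻ z, ENNReal.ofReal (‖u z‖ ^ p z * omegaWeight p φ z) *
      ENNReal.ofReal (dens (φ z)) * nearIndicator (φ z, ζ) ∂ballVolume n ≤ ENNReal.ofReal B := by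
  obtain ⟨P, hP⟩ := hp.exists_bounds
  have hp1 : ∀ z ∈ unitBall n, 1 ≤ p z := fun z hz => (hP z hz).1
  obtain ⟨M, K, hK, hmod⟩ := hp.exists_modular_testFn_le
  obtain ⟨L, hL, hT⟩ := hC.exists_modular_le hp1 hK
  obtain ⟨D, hD, htest⟩ := hp.exists_dens_rpow_le_norm_testFn M
  have hL0 : 0 < L := by linarith
  have hD0 : 0 < D := by linarith
  have hDL : 1 ≤ D * L := one_le_mul_of_one_le_of_one_le hD hL
  refine ⟨(D * L) ^ P, by positivity, fun ζ => ?_⟩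
  by_cases hζ : ζ ∈ unitBall n
  swap
  · have : ∀ z, nearIndicator (φ z, ζ) = 0 :=
      fun z => nearIndicator_of_not_near fun h => hζ h.2.1
    simp [this]
  obtain ⟨-, hm⟩ := hT _ (differentiableOn_testFn M hζ) (hmod ζ hζ)
  calc ∫⁻ z, ENNReal.ofReal (‖u z‖ ^ p z * omegaWeight p φ z) * ENNReal.ofReal (dens (φ z)) *
        nearIndicator (φ z, ζ) ∂ballVolume n
      ≤ ∫⁻ z, ENNReal.ofReal ((D * L) ^ P) * ENNReal.ofReal
          (‖wComp u φ (testFn p M ζ) z / (L : ℂ)‖ ^ p z) ∂ballVolume n := by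
        refine lintegral_mono_ae ?_
        filter_upwards [ae_mem_unitBall] with z hz
        by_cases hn : Near (φ z) ζ
        swap
        · rw [nearIndicator_of_not_near hn, mul_zero]; exact zero_le
        have hw := hφ_self hz
        have hd := dens_pos hw
        have hpz := hp1 z hz
        rw [nearIndicator_of_near hn,
          mul_one, ← ENNReal.ofReal_mul' hd.le, ← ENNReal.ofReal_mul (by positivity), mul_assoc,
          omegaWeight_mul_dens hw (by linarith) (by linarith [hp1 _ hw])]
        refine ENNReal.ofReal_le_ofReal ?_
        have h1 : ‖wComp u φ (testFn p M ζ) z / (L : ℂ)‖ = ‖u z‖ * ‖testFn p M ζ (φ z)‖ / L := by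
          rw [wComp, norm_div, norm_mul, Complex.norm_real, Real.norm_eq_abs, abs_of_pos hL0]
        rw [h1]
        calc ‖u z‖ ^ p z * (dens (φ z) ^ (1 / p (φ z))) ^ p z
            = (‖u z‖ * dens (φ z) ^ (1 / p (φ z))) ^ p z :=
              (Real.mul_rpow (norm_nonneg _) (by positivity)).symm
          _ ≤ (D * L * (‖u z‖ * ‖testFn p M ζ (φ z)‖ / L)) ^ p z := by
              -- Since ζ is near φ(z), the test function peaking at ζ is still of full size at φ(z).
              refine Real.rpow_le_rpow (by positivity) ?_ (by linarith)
              calc ‖u z‖ * dens (φ z) ^ (1 / p (φ z))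
                  ≤ ‖u z‖ * (D * ‖testFn p M ζ (φ z)‖) := by
                    gcongr; exact htest _ _ hn.symm
                _ = _ := by field_simp
          _ = (D * L) ^ p z * (‖u z‖ * ‖testFn p M ζ (φ z)‖ / L) ^ p z :=
              Real.mul_rpow (by positivity) (by positivity)
          _ ≤ _ := by
              gcongr
              exact (hP z hz).2
    _ = ENNReal.ofReal ((D * L) ^ P) * modular p (ballVolume n)
          (fun z => wComp u φ (testFn p M ζ) z / (L : ℂ)) := by
        rw [lintegral_const_mul' _ _ ENNReal.ofReal_ne_top, modular, restrict_ballVolume]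
    _ ≤ ENNReal.ofReal ((D * L) ^ P) * 1 := by gcongr
    _ = _ := mul_one _

theorem isCarleson_pullbackMeasure (hp : LogExponent p) {u : Cn n → ℂ}
    (hu : ContinuousOn u (unitBall n)) {φ : Cn n → Cn n} (hφ : ContinuousOn φ (unitBall n))
    (hφ_self : Set.MapsTo φ (unitBall n) (unitBall n)) (hC : WCompBounded p u φ) :
    IsCarleson p (pullbackMeasure p u φ) := by
  have hp1 := hp.one_le
  obtain ⟨C, hC0, hpt⟩ := hp.exists_point_estimate
  obtain ⟨B, hB0, hkernel⟩ := hp.exists_lintegral_near_le hφ_self hC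
  refine isCarleson_of_modular_le hp1 (K := max 1 (C * (B * 2))) (le_max_left _ _)
    fun f hf hfm => ?_
  have hu_meas : ContinuousOn (fun z => ‖u z‖ ^ p z) (unitBall n) :=
    continuousOn_norm_rpow hp.continuousOn hp1 hu
  have hω := continuousOn_omegaWeight hp.continuousOn hp1 hφ hφ_self
  let T : Cn n → ℝ≥0∞ := fun z => ENNReal.ofReal (‖u z‖ ^ p z * omegaWeight p φ z)
  have hTm : AEMeasurable T (ballVolume n) :=
    (aemeasurable_ballVolume (hu_meas.mul hω)).ennreal_ofReal
  let h : Cn n → ℝ≥0∞ := fun z => 1 + ENNReal.ofReal (‖f z‖ ^ p z)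
  have hhm : AEMeasurable h (ballVolume n) :=
    ((aemeasurable_ballVolume (continuousOn_norm_rpow hp.continuousOn hp1
      hf.continuousOn)).ennreal_ofReal).const_add 1
  have hφm : AEMeasurable φ (ballVolume n) := aemeasurable_ballVolume hφ
  have hdm : AEMeasurable (fun z => ENNReal.ofReal (dens (φ z))) (ballVolume n) := by
    refine (aemeasurable_ballVolume ?_).ennreal_ofReal
    refine ContinuousOn.inv₀ ((continuousOn_const.sub (hφ.norm.pow 2)).pow _) fun z hz => ?_
    exact (pow_pos (one_sub_sq_pos (hφ_self hz)) _).ne'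
  calc modular p (pullbackMeasure p u φ) f
      = ∫⁻ w, (unitBall n).indicator (fun w => ENNReal.ofReal (‖f w‖ ^ p w)) w
          ∂pullbackMeasure p u φ := (lintegral_indicator Metric.isOpen_ball.measurableSet _).symm
    _ ≤ ∫⁻ z, T z * (unitBall n).indicator (fun w => ENNReal.ofReal (‖f w‖ ^ p w)) (φ z)
          ∂ballVolume n := lintegral_pullbackMeasure_le hTm _
    _ ≤ ∫⁻ z, ENNReal.ofReal C * ∫⁻ ζ, T z * ENNReal.ofReal (dens (φ z)) * nearIndicator (φ z, ζ) * h ζ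
          ∂ballVolume n ∂ballVolume n := by
        refine lintegral_mono_ae ?_
        filter_upwards [ae_mem_unitBall] with z hz
        have hw := hφ_self hz
        have hN' : ∀ ζ, nearIndicator (φ z, ζ) * h ζ = {ζ | Near (φ z) ζ}.indicator h ζ := by
          intro ζ
          by_cases hn : Near (φ z) ζ
          · rw [Set.indicator_of_mem (s := {ζ | Near (φ z) ζ}) hn, nearIndicator_of_near hn, one_mul]
          · rw [Set.indicator_of_notMem (s := {ζ | Near (φ z) ζ}) hn, nearIndicator_of_not_near hn,
              zero_mul]
        rw [Set.indicator_of_mem hw]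
        simp only [mul_assoc, hN']
        rw [lintegral_const_mul' _ _ ENNReal.ofReal_ne_top,
          lintegral_const_mul' _ _ ENNReal.ofReal_ne_top,
          lintegral_indicator (measurableSet_near_left _), mul_left_comm]
        gcongr
        rw [← mul_assoc, ← ENNReal.ofReal_mul hC0.le]
        exact hpt f hf hfm _ hw
    -- Tonelli: the inner integral becomes the Carleson quantity of the Bergman ball at ζ, bounded
    -- uniformly in ζ.
    _ = ENNReal.ofReal C * ∫⁻ ζ, h ζ * ∫⁻ z, T z * ENNReal.ofReal (dens (φ z)) * nearIndicator (φ z, ζ)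
          ∂ballVolume n ∂ballVolume n := by
        rw [lintegral_const_mul' _ _ ENNReal.ofReal_ne_top, lintegral_lintegral_swap]
        · congr 1
          refine lintegral_congr fun ζ => ?_
          rw [← lintegral_const_mul' _ _ (by simp [h])]
          simp only [mul_comm (h ζ)]
        · refine ((((hTm.mul hdm).comp_fst).mul ?_)).mul hhm.comp_snd
          exact measurable_nearIndicator.comp_aemeasurable (hφm.comp_fst.prodMk measurable_snd.aemeasurable)
    _ ≤ ENNReal.ofReal C * ∫⁻ ζ, h ζ * ENNReal.ofReal (B) ∂ballVolume n := by
        gcongr with ζ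
        exact hkernel ζ
    _ = ENNReal.ofReal C * (ENNReal.ofReal (B) * ∫⁻ ζ, h ζ ∂ballVolume n) := by
        rw [lintegral_mul_const' _ _ ENNReal.ofReal_ne_top, mul_comm (ENNReal.ofReal (B))]
    _ ≤ ENNReal.ofReal C * (ENNReal.ofReal (B) * 2) := by
        gcongr
        exact lintegral_one_add_le_two hfm
    _ = ENNReal.ofReal (C * (B * 2)) := by
        rw [ENNReal.ofReal_mul hC0.le, ENNReal.ofReal_mul hB0.le, ENNReal.ofReal_ofNat]
    _ ≤ _ := ENNReal.ofReal_le_ofReal (le_max_right _ _)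

theorem WCompBounded.weight_mem_bergman {u : Cn n → ℂ} {φ : Cn n → Cn n}
    (hC : WCompBounded p u φ) : u ∈ bergman p := by
  obtain ⟨C, -, hC⟩ := hC
  have h1 : (fun _ : Cn n => (1 : ℂ)) ∈ bergman p := by
    refine ⟨differentiableOn_const _, ?_⟩
    rw [modular, restrict_ballVolume]
    simp
  have h2 : wComp u φ (fun _ => 1) = u := funext fun z => mul_one _
  exact h2 ▸ (hC _ h1).1

end VarBergman

theorem proposition4p1 (n : ℕ) (hn : 1 ≤ n)
    (p : VarBergman.Cn n → ℝ) (hp : VarBergman.LogExponent p)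
    (u : VarBergman.Cn n → ℂ) (hu : DifferentiableOn ℂ u (VarBergman.unitBall n))
    (φ : VarBergman.Cn n → VarBergman.Cn n)
    (hφ : DifferentiableOn ℂ φ (VarBergman.unitBall n))
    (hφ_self : Set.MapsTo φ (VarBergman.unitBall n) (VarBergman.unitBall n))
    (hC : VarBergman.WCompBounded p u φ) :
    u ∈ VarBergman.bergman p ∧
    BddAbove ((fun z : VarBergman.Cn n =>
      ‖u z‖ * ((1 - ‖z‖ ^ 2) ^ (((n : ℝ) + 1) / p z) /
        (1 - ‖φ z‖ ^ 2) ^ (((n : ℝ) + 1) / p (φ z)))) '' VarBergman.unitBall n) ∧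
    VarBergman.IsCarleson p (VarBergman.pullbackMeasure p u φ) :=
  ⟨hC.weight_mem_bergman, VarBergman.bddAbove_of_wCompBounded hp hφ_self hC,
    VarBergman.isCarleson_pullbackMeasure hp hu.continuousOn hφ.continuousOn hφ_self hC⟩
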